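/- Let $(M^n,\langle\cdot,\cdot\rangle)$ and $(N^k,\langle\cdot,\cdot\rangle)$ be smooth Riemannian manifolds without boundary (Hausdorff, second countable), let $\xi$ be a Killing vector field on $N$, that is, a smooth vector field with $\langle\overline\nabla_X\xi,Y\rangle+\langle X,\overline\nabla_Y\xi\rangle=0$ for all tangent vectors $X,Y$ of $N$ at the same point, where $\overline\nabla$ is the Levi-Civita connection of $N$. Let $f:M\to N$ be a smooth isometric immersion that is a soliton for the mean curvature flow with respect to $\xi$: $$\mathbf H=\xi^{\perp}\quad\text{on } M,$$ where $\mathbf H$ is the (unnormalized) mean curvature vector of $f$, i.e. the trace of its second fundamental form, and $\xi^\top$, $\xi^\perp$ denote the tangential and normal parts of $\xi$ along $f$, $\xi^\top$ being regarded as a vector field on $M$. Then $$\operatorname{div}(\xi^{\top})=H^2\quad\text{on } M,\qquad\text{where } H^2=\langle\mathbf H,\mathbf H\rangle .$$ Consequently, if $M$ is compact, then $f$ is minimal, i.e. $\mathbf H\equiv 0$. -/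

import Mathlib

open scoped Manifold ContDiff

noncomputable section

namespace MCFSoliton

/-- `R n` is Euclidean space `ℝⁿ`, the model space of `n`-dimensional manifolds. -/
abbrev R (n : ℕ) : Type := EuclideanSpace ℝ (Fin n)

/-- A smooth Riemannian metric on a smooth `n`-dimensional manifold (without boundary). -/
abbrev Metric (n : ℕ) (M : Type*) [TopologicalSpace M] [ChartedSpace (R n) M]
    [IsManifold (𝓡 n) ∞ M] : Type _ :=
  Bundle.ContMDiffRiemannianMetric (𝓡 n) ∞ (R n) (fun x : M => TangentSpace (𝓡 n) x)

section OneManifold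

variable {n : ℕ} {M : Type*} [TopologicalSpace M] [ChartedSpace (R n) M] [IsManifold (𝓡 n) ∞ M]

/-- The inner product `g_x`, as a bilinear form on `ℝⁿ`. In Mathlib the tangent space at `x` is by
definition the model space `ℝⁿ`, through the differential at `x` of the preferred chart at `x`. -/
def metricAt (g : Metric n M) (x : M) : R n →L[ℝ] R n →L[ℝ] ℝ := g.inner x

theorem metricAt_bijective (g : Metric n M) (x : M) : Function.Bijective (metricAt g x) := by
  have hinj : Function.Injective (metricAt g x) := by
    rw [injective_iff_map_eq_zero]
    intro v hv
    by_contra hne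
    have h1 : 0 < metricAt g x v v := g.pos x v hne
    rw [hv] at h1
    simp at h1
  have hdim : Module.finrank ℝ (R n) = Module.finrank ℝ (R n →L[ℝ] ℝ) := by
    rw [← (LinearMap.toContinuousLinearMap : (R n →ₗ[ℝ] ℝ) ≃ₗ[ℝ] (R n →L[ℝ] ℝ)).finrank_eq]
    exact (Subspace.dual_finrank_eq (K := ℝ) (V := R n)).symm
  have : FiniteDimensional ℝ (R n →L[ℝ] ℝ) :=
    (LinearMap.toContinuousLinearMap : (R n →ₗ[ℝ] ℝ) ≃ₗ[ℝ] (R n →L[ℝ] ℝ)).finiteDimensional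
  exact ⟨hinj, (LinearMap.injective_iff_surjective_of_finrank_eq_finrank
    (f := (metricAt g x).toLinearMap) hdim).1 hinj⟩

/-- The musical isomorphism `φ ↦ φ^♯` at `x`: the tangent vector with `g_x(φ^♯, v) = φ v` for all
`v` (see `metricAt_sharp`). -/
def sharp (g : Metric n M) (x : M) (φ : R n →L[ℝ] ℝ) : R n := (metricAt g x).inverse φ

theorem metricAt_sharp (g : Metric n M) (x : M) (φ : R n →L[ℝ] ℝ) (v : R n) :
    metricAt g x (sharp g x φ) v = φ v := by
  have : FiniteDimensional ℝ (R n →L[ℝ] ℝ) :=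
    (LinearMap.toContinuousLinearMap : (R n →ₗ[ℝ] ℝ) ≃ₗ[ℝ] (R n →L[ℝ] ℝ)).finiteDimensional
  let e : R n ≃L[ℝ] (R n →L[ℝ] ℝ) :=
    (LinearEquiv.ofBijective (metricAt g x).toLinearMap (metricAt_bijective g x)).toContinuousLinearEquiv
  have he : metricAt g x = (e : R n →L[ℝ] (R n →L[ℝ] ℝ)) := by
    ext a b; rfl
  have h2 : metricAt g x (sharp g x φ) = φ := by
    unfold sharp
    rw [he, ContinuousLinearMap.inverse_equiv]
    exact e.apply_symm_apply φ
  rw [h2]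

/-- The differential at `y` of the preferred chart at `x`: it sends a tangent vector at `y` to its
components in the chart at `x`. -/
def dChart (x y : M) : R n →L[ℝ] R n := mfderiv (𝓡 n) 𝓘(ℝ, R n) (extChartAt (𝓡 n) x) y

/-- The differential at `u` of the inverse of the preferred chart at `x`: it sends a vector to the
tangent vector with these components in the chart at `x`. -/
def dChartSymm (x : M) (u : R n) : R n →L[ℝ] R n :=
  mfderiv 𝓘(ℝ, R n) (𝓡 n) (extChartAt (𝓡 n) x).symm u

/-- The metric in the chart at `x`: the components `g_ij(u)` at the point with coordinates `u`. -/
def chartMetric (g : Metric n M) (x : M) (u : R n) : R n →L[ℝ] R n →L[ℝ] ℝ :=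
  (metricAt g ((extChartAt (𝓡 n) x).symm u)).bilinearComp (dChartSymm x u) (dChartSymm x u)

/-- The first derivatives of the components of the metric in the chart at `x`, taken at `x`:
`dMetric g x a b c` is `∂_a (g(b, c))`. -/
def dMetric (g : Metric n M) (x : M) : R n →L[ℝ] R n →L[ℝ] R n →L[ℝ] ℝ :=
  fderiv ℝ (chartMetric g x) (extChartAt (𝓡 n) x x)

/-- The Christoffel symbols of the Levi-Civita connection at `x`, in the chart at `x`:
`g(Γ(a, b), c) = (∂_a g(b, c) + ∂_b g(a, c) - ∂_c g(a, b)) / 2`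
(see `metricAt_christoffel`). -/
def christoffel (g : Metric n M) (x : M) (a b : R n) : R n :=
  sharp g x ((1 / 2 : ℝ) •
    (dMetric g x a b + dMetric g x b a - ((dMetric g x).flip a).flip b))

theorem metricAt_christoffel (g : Metric n M) (x : M) (a b c : R n) :
    metricAt g x (christoffel g x a b) c =
      (dMetric g x a b c + dMetric g x b a c - dMetric g x c a b) / 2 := by
  rw [christoffel, metricAt_sharp]
  simp
  ring

/-- The trace with respect to `g_x` of a bilinear map `B` on the tangent space at `x`,
`∑ i j, g^{ij} B(∂_i, ∂_j)`; here `∑ j, g^{ij} ∂_j = (dx^i)^♯`. It is equal to `∑ i, B(e_i, e_i)`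
for every `g_x`-orthonormal basis `e` (see `metricTrace_eq_sum`). -/
def metricTrace (g : Metric n M) (x : M) {F : Type*} [AddCommGroup F] (B : R n → R n → F) : F :=
  ∑ i, B (EuclideanSpace.single i 1) (sharp g x (EuclideanSpace.proj i))

theorem metricTrace_eq_sum (g : Metric n M) (x : M) {F : Type*} [AddCommGroup F] [Module ℝ F]
    (B : R n →ₗ[ℝ] R n →ₗ[ℝ] F) (e : Module.Basis (Fin n) ℝ (R n))
    (he : ∀ i j, metricAt g x (e i) (e j) = if i = j then 1 else 0) :
    metricTrace g x (fun v w => B v w) = ∑ i, B (e i) (e i) := by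
  have hexp : ∀ w : R n, w = ∑ j, metricAt g x w (e j) • e j := by
    intro w
    have h : ∀ j, metricAt g x w (e j) = e.repr w j := by
      intro j
      have h0 : metricAt g x (∑ i, e.repr w i • e i) (e j) = e.repr w j := by
        rw [map_sum]
        simp [he]
      rwa [e.sum_repr] at h0
    simp_rw [h]
    exact (e.sum_repr w).symm
  have hs : ∀ w : R n, w = ∑ i, w i • EuclideanSpace.single i (1 : ℝ) := by
    intro w
    ext j
    simp [Pi.single_apply]
  unfold metricTrace
  calc ∑ i, B (EuclideanSpace.single i 1) (sharp g x (EuclideanSpace.proj i))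
      = ∑ i, ∑ j, (e j) i • B (EuclideanSpace.single i 1) (e j) := by
        refine Finset.sum_congr rfl fun i _ => ?_
        conv_lhs => rw [hexp (sharp g x (EuclideanSpace.proj i))]
        simp [metricAt_sharp]
    _ = ∑ j, B (∑ i, (e j) i • EuclideanSpace.single i (1 : ℝ)) (e j) := by
        rw [Finset.sum_comm]
        simp
    _ = ∑ j, B (e j) (e j) := by
        refine Finset.sum_congr rfl fun j _ => ?_
        rw [← hs]

end OneManifold

section TwoManifolds

variable {n k : ℕ}
  {M : Type*} [TopologicalSpace M] [ChartedSpace (R n) M] [IsManifold (𝓡 n) ∞ M]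
  {N : Type*} [TopologicalSpace N] [ChartedSpace (R k) N] [IsManifold (𝓡 k) ∞ N]

/-- The differential of `f` at `p`. -/
def diff (f : M → N) (p : M) : R n →L[ℝ] R k := mfderiv (𝓡 n) (𝓡 k) f p

/-- The differential at `p` of the components of `W` in the chart of `N` at `f p`, where `W` is a
vector field along the map `f : M → N`. -/
def componentDeriv (f : M → N) (W : (q : M) → TangentSpace (𝓡 k) (f q)) (p : M) :
    R n →L[ℝ] R k :=
  mfderiv (𝓡 n) 𝓘(ℝ, R k) (fun q => dChart (f p) (f q) (W q)) p

/-- The covariant derivative at `p`, in the direction `v`, of a vector field `W` along the map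
`f : M → N`, for the Levi-Civita connection of `N`: the derivative in the direction `v` of the
components of `W` in the chart of `N` at `f p`, plus `Γ(df(v), W(p))`. In the chart at `f p` a
tangent vector at `f p` is its own vector of components. -/
def covDerivAlong (gN : Metric k N) (f : M → N) (W : (q : M) → TangentSpace (𝓡 k) (f q))
    (p : M) (v : R n) : R k :=
  componentDeriv f W p v + christoffel gN (f p) (diff f p v) (W p)

/-- The Levi-Civita covariant derivative `∇_v X` at `p` of a vector field `X` on `M`. -/
def covDeriv (gM : Metric n M) (X : (q : M) → TangentSpace (𝓡 n) q) (p : M) (v : R n) : R n :=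
  covDerivAlong gM (fun q : M => q) X p v

/-- The divergence `div X = ∑ i, ⟨∇_{e_i} X, e_i⟩` of a vector field `X` on `M`. -/
def divergence (gM : Metric n M) (X : (q : M) → TangentSpace (𝓡 n) q) (p : M) : ℝ :=
  metricTrace gM p (fun v w => metricAt gM p (covDeriv gM X p v) w)

/-- `ξ` is a Killing vector field: a smooth vector field with
`⟨∇_v ξ, w⟩ + ⟨v, ∇_w ξ⟩ = 0` for all tangent vectors `v`, `w` at the same point. -/
structure IsKilling (gN : Metric k N) (ξ : (y : N) → TangentSpace (𝓡 k) y) : Prop where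
  smooth : ContMDiff (𝓡 k) (𝓡 k).tangent ∞ (fun y => (⟨y, ξ y⟩ : TangentBundle (𝓡 k) N))
  killing : ∀ (y : N) (v w : R k),
    metricAt gN y (covDeriv gN ξ y v) w + metricAt gN y v (covDeriv gN ξ y w) = 0

/-- `f : (M, gM) → (N, gN)` is a smooth isometric immersion. (Such a map is an immersion because
`gM` is positive definite.) -/
structure IsIsometricImmersion (gM : Metric n M) (gN : Metric k N) (f : M → N) : Prop where
  smooth : ContMDiff (𝓡 n) (𝓡 k) ∞ f
  isometric : ∀ (p : M) (v w : R n),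
    metricAt gN (f p) (diff f p v) (diff f p w) = metricAt gM p v w

/-- The tangential part `W^⊤` at `p` of a vector `W ∈ T_{f(p)}N`, as an element of `T_pM`: it is
determined by `⟨W^⊤, v⟩ = ⟨W, df(v)⟩` for all `v ∈ T_pM`. -/
def tangentPart (gM : Metric n M) (gN : Metric k N) (f : M → N) (p : M) (W : R k) : R n :=
  sharp gM p ((metricAt gN (f p) W).comp (diff f p))

/-- The normal part `W^⊥ = W - df(W^⊤)` of a vector `W ∈ T_{f(p)}N`. -/
def normalPart (gM : Metric n M) (gN : Metric k N) (f : M → N) (p : M) (W : R k) : R k :=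
  W - diff f p (tangentPart gM gN f p W)

theorem normalPart_orthogonal (gM : Metric n M) (gN : Metric k N) (f : M → N)
    (hf : IsIsometricImmersion gM gN f) (p : M) (W : R k) (v : R n) :
    metricAt gN (f p) (normalPart gM gN f p W) (diff f p v) = 0 := by
  simp [normalPart, tangentPart, hf.isometric, metricAt_sharp]

/-- The vector field near `p` that is equal to `w` at `p` and has constant components in the chart
at `p`. -/
def constField (p : M) (w : R n) (q : M) : TangentSpace (𝓡 n) q :=
  dChartSymm p (extChartAt (𝓡 n) p q) w

/-- The second fundamental form `A(v, w) = (∇̄_v df(Y))^⊥` of `f` at `p`, where `Y` is a local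
vector field that extends `w` (the result does not depend on the extension, here `constField p w`).
-/
def secondFundamentalForm (gM : Metric n M) (gN : Metric k N) (f : M → N) (p : M)
    (v w : R n) : R k :=
  normalPart gM gN f p (covDerivAlong gN f (fun q => diff f q (constField p w q)) p v)

/-- The (unnormalized) mean curvature vector of `f` at `p`, the trace of the second fundamental
form. -/
def meanCurvature (gM : Metric n M) (gN : Metric k N) (f : M → N) (p : M) : R k :=
  metricTrace gM p (secondFundamentalForm gM gN f p)

/-- `f` is a soliton for the mean curvature flow with respect to `ξ`: an isometric immersion whose
mean curvature vector is the normal part of `ξ`. -/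
structure IsSoliton (gM : Metric n M) (gN : Metric k N) (f : M → N)
    (ξ : (y : N) → TangentSpace (𝓡 k) y) : Prop where
  immersion : IsIsometricImmersion gM gN f
  soliton : ∀ p, meanCurvature gM gN f p = normalPart gM gN f p (ξ (f p))

/-- `f` is minimal: its mean curvature vector vanishes identically. -/
def IsMinimal (gM : Metric n M) (gN : Metric k N) (f : M → N) : Prop :=
  ∀ p, meanCurvature gM gN f p = 0

end TwoManifolds

end MCFSoliton

end

/-!
The identity `div ξ^⊤ = H²` is a computation in coordinates. For every vector field `X`,
symmetrizing the covariant derivative removes the Christoffel symbols,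
`⟨∇_v X, w⟩ + ⟨v, ∇_w X⟩ = (L_X g)(v, w)`
(`metricAt_covDeriv_add`), so `div X` is half of the trace of the Lie derivative `L_X g`
(`divergence_eq_sum`), and a Killing field `ξ` is one with `L_ξ g = 0`. Let `F` be the coordinate
expression of `f`, let `T = ξ^⊤`, and let `ν = ξ - df(T) = ξ^⊥`. Differentiating the equation
`g(T, b) = ⟨ξ, dF(b)⟩` that defines `T`, and using `L_ξ g_N = 0`, gives
`(L_T g)(a, a) / 2 = ⟨ν, D²F(a, a) + Γ(dF(a), dF(a))⟩ = ⟨ξ^⊥, A(a, a)⟩`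
(`lieMetric_tangentPart`, `lieMetric_tangentField`). The trace of the right-hand side is
`⟨ξ^⊥, H⟩ = ⟨H, H⟩` for a soliton.

If `M` is compact, it remains to see that a field `X` with `div X ≥ 0` has `div X = 0`
(`divergence_eq_zero_of_nonneg`). Lie derivatives of metrics are natural under changes of
coordinates (`lieMetric_pullback`), so the formula `√det g · div X = ∑ i, ∂_i (√det g · X^i)` holds
in every chart (`density_mul_divergence`). For a function `h` supported in one chart, integration by
parts gives `∫ h div X = - ∫ X h` (`chartIntegral_mul_divergence`), and the integral of a function
supported in two charts does not depend on the chart (`chartIntegral_congr_chart`). For a partition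
of unity `ρ` subordinate to the charts,
`∑ i, ∫ ρ_i div X = - ∑ i j, ∫ ρ_j X ρ_i = - ∑ j, ∫ ρ_j X (∑ i, ρ_i) = 0`.
All integrals on the left have nonnegative continuous integrands, so all integrands vanish. No
measure on `M` and no orientation are needed.
-/

noncomputable section

namespace MCFSoliton

open Set Filter Topology MeasureTheory

/-! ### Tensors in charts -/

section Charts

variable {n k : ℕ}
  {M : Type*} [TopologicalSpace M] [ChartedSpace (R n) M]
  {N : Type*} [TopologicalSpace N] [ChartedSpace (R k) N]

theorem isOpen_target (c : M) : IsOpen (extChartAt (𝓡 n) c).target := isOpen_extChartAt_target c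

/-- The components, in the chart at `c`, of the vector field `X`, as a function of the
coordinates. -/
def chartField (X : (q : M) → TangentSpace (𝓡 n) q) (c : M) (u : R n) : R n :=
  dChart c ((extChartAt (𝓡 n) c).symm u) (X ((extChartAt (𝓡 n) c).symm u))

/-- The coordinate expression of `f` in the charts at `c` and `d`. -/
def chartRep (f : M → N) (c : M) (d : N) : R n → R k :=
  extChartAt (𝓡 k) d ∘ f ∘ (extChartAt (𝓡 n) c).symm

theorem chartField_extChartAt (X : (q : M) → TangentSpace (𝓡 n) q) (c : M) {q : M}
    (hq : q ∈ (extChartAt (𝓡 n) c).source) :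
    chartField X c (extChartAt (𝓡 n) c q) = dChart c q (X q) := by
  unfold chartField
  rw [(extChartAt (𝓡 n) c).left_inv hq]

theorem chartRep_apply (f : M → N) (c : M) (d : N) (u : R n) :
    (chartRep f c d u : R k) = extChartAt (𝓡 k) d (f ((extChartAt (𝓡 n) c).symm u)) := rfl

theorem chartRep_self (f : M → N) (p : M) :
    (chartRep f p (f p) (extChartAt (𝓡 n) p p) : R k) = extChartAt (𝓡 k) (f p) (f p) := by
  rw [chartRep_apply, extChartAt_to_inv]

theorem diff_id (p : M) : diff (fun q : M => q) p = ContinuousLinearMap.id ℝ (R n) := mfderiv_id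

/-- The points at which the coordinate expression of `f` in the charts at `c` and `d` makes sense
form an open set. -/
theorem eventually_mem_chartRep_domain {f : M → N} (hf : Continuous f) (c : M) (d : N) {u : R n}
    (hu : u ∈ (extChartAt (𝓡 n) c).target)
    (hd : f ((extChartAt (𝓡 n) c).symm u) ∈ (extChartAt (𝓡 k) d).source) :
    ∀ᶠ v in 𝓝 u, v ∈ (extChartAt (𝓡 n) c).target ∧
      f ((extChartAt (𝓡 n) c).symm v) ∈ (extChartAt (𝓡 k) d).source := by
  refine Filter.Eventually.and ((isOpen_target c).mem_nhds hu) ?_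
  have hc : ContinuousAt (fun v => f ((extChartAt (𝓡 n) c).symm v)) u :=
    hf.continuousAt.comp
      ((continuousOn_extChartAt_symm c).continuousAt ((isOpen_target c).mem_nhds hu))
  exact hc.eventually ((isOpen_extChartAt_source d).mem_nhds hd)

variable [IsManifold (𝓡 n) ∞ M] [IsManifold (𝓡 k) ∞ N]

theorem dChart_comp_dChartSymm (c : M) {u : R n} (hu : u ∈ (extChartAt (𝓡 n) c).target) :
    (dChart c ((extChartAt (𝓡 n) c).symm u)).comp (dChartSymm c u) =
      ContinuousLinearMap.id ℝ (R n) := by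
  have h := mfderiv_extChartAt_comp_mfderivWithin_extChartAt_symm (I := 𝓡 n) hu
  rw [(𝓡 n).range_eq_univ, mfderivWithin_univ] at h
  exact h

theorem dChartSymm_comp_dChart (c : M) {u : R n} (hu : u ∈ (extChartAt (𝓡 n) c).target) :
    (dChartSymm c u).comp (dChart c ((extChartAt (𝓡 n) c).symm u)) =
      ContinuousLinearMap.id ℝ (R n) := by
  have h := mfderivWithin_extChartAt_symm_comp_mfderiv_extChartAt (I := 𝓡 n) hu
  rw [(𝓡 n).range_eq_univ, mfderivWithin_univ] at h
  exact h

theorem dChart_dChartSymm_apply (c : M) {u : R n} (hu : u ∈ (extChartAt (𝓡 n) c).target)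
    (a : R n) : dChart c ((extChartAt (𝓡 n) c).symm u) (dChartSymm c u a) = a :=
  DFunLike.congr_fun (dChart_comp_dChartSymm c hu) a

theorem dChartSymm_dChart_apply (c : M) {u : R n} (hu : u ∈ (extChartAt (𝓡 n) c).target)
    (a : R n) : dChartSymm c u (dChart c ((extChartAt (𝓡 n) c).symm u) a) = a :=
  DFunLike.congr_fun (dChartSymm_comp_dChart c hu) a

theorem dChart_self (c : M) : dChart c c = ContinuousLinearMap.id ℝ (R n) :=
  mfderiv_extChartAt_self (I := 𝓡 n)

theorem dChartSymm_self (c : M) :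
    dChartSymm c (extChartAt (𝓡 n) c c) = ContinuousLinearMap.id ℝ (R n) := by
  have h := mfderivWithin_range_extChartAt_symm (I := 𝓡 n) (x := c)
  rw [(𝓡 n).range_eq_univ, mfderivWithin_univ] at h
  exact h

/-- In the trivialization of the tangent bundle at `c`, a tangent vector is represented by its
components in the chart at `c`. -/
theorem trivializationAt_eq_dChart (c q : M) (hq : q ∈ (chartAt (R n) c).source) (v : R n) :
    ((trivializationAt (R n) (TangentSpace (𝓡 n)) c)
      (⟨q, v⟩ : TangentBundle (𝓡 n) M)).2 = dChart c q v := by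
  have h := TangentBundle.continuousLinearMapAt_trivializationAt (I := 𝓡 n) (𝕜 := ℝ) hq
  have h2 := DFunLike.congr_fun h v
  have hq' : q ∈ (trivializationAt (R n) (TangentSpace (𝓡 n) (M := M)) c).baseSet := by
    simpa using hq
  have h3 := (trivializationAt (R n) (TangentSpace (𝓡 n) (M := M)) c).linearMapAt_apply
    (R := ℝ) (b := q) v
  rw [if_pos hq'] at h3
  exact h3.symm.trans h2

/-- A vector field is smooth on the domain of a chart if its components are. -/
theorem contMDiffOn_section_iff (c : M) (X : (q : M) → TangentSpace (𝓡 n) q) :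
    ContMDiffOn (𝓡 n) (𝓡 n).tangent ∞ (fun q => (⟨q, X q⟩ : TangentBundle (𝓡 n) M))
      (chartAt (R n) c).source ↔
    ContMDiffOn (𝓡 n) 𝓘(ℝ, R n) ∞ (fun q => dChart c q (X q)) (chartAt (R n) c).source := by
  have h := (trivializationAt (R n) (TangentSpace (𝓡 n)) c).contMDiffOn_section_baseSet_iff
    (IB := 𝓡 n) (n := ∞) (s := X)
  rw [TangentBundle.trivializationAt_baseSet] at h
  refine h.trans (contMDiffOn_congr fun q hq => ?_)
  exact trivializationAt_eq_dChart c q hq (X q)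

theorem ContMDiffOn.contDiffOn_comp_extChartAt_symm {F : Type*} [NormedAddCommGroup F]
    [NormedSpace ℝ F] {h : M → F} {c : M}
    (hh : ContMDiffOn (𝓡 n) 𝓘(ℝ, F) ∞ h (chartAt (R n) c).source) :
    ContDiffOn ℝ ∞ (h ∘ (extChartAt (𝓡 n) c).symm) (extChartAt (𝓡 n) c).target := by
  rw [← contMDiffOn_iff_contDiffOn]
  refine hh.comp (contMDiffOn_extChartAt_symm c) fun u hu => ?_
  have := (extChartAt (𝓡 n) c).map_target hu
  rwa [extChartAt_source] at this

theorem contDiffOn_chartField {X : (q : M) → TangentSpace (𝓡 n) q}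
    (hX : ContMDiff (𝓡 n) (𝓡 n).tangent ∞ (fun q => (⟨q, X q⟩ : TangentBundle (𝓡 n) M)))
    (c : M) : ContDiffOn ℝ ∞ (chartField X c) (extChartAt (𝓡 n) c).target :=
  ContMDiffOn.contDiffOn_comp_extChartAt_symm ((contMDiffOn_section_iff c X).1 hX.contMDiffOn)

theorem contDiffOn_chartMetric (g : Metric n M) (c : M) :
    ContDiffOn ℝ ∞ (chartMetric g c) (extChartAt (𝓡 n) c).target := by
  rw [contDiffOn_clm_apply]
  intro a
  rw [contDiffOn_clm_apply]
  intro b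
  -- the coordinate vector fields are smooth, since their components are constant
  have hs : ∀ a : R n, ContMDiffOn (𝓡 n) (𝓡 n).tangent ∞
      (fun q => (⟨q, dChartSymm c (extChartAt (𝓡 n) c q) a⟩ : TangentBundle (𝓡 n) M))
      (chartAt (R n) c).source := by
    intro a
    refine (contMDiffOn_section_iff c
      (fun q => dChartSymm c (extChartAt (𝓡 n) c q) a)).2 ?_
    refine (contMDiffOn_const (c := a)).congr fun q hq => ?_
    rw [← extChartAt_source (𝓡 n)] at hq
    have h := dChart_dChartSymm_apply c ((extChartAt (𝓡 n) c).map_source hq) a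
    rwa [(extChartAt (𝓡 n) c).left_inv hq] at h
  have h := (g.contMDiff.contMDiffOn (s := (chartAt (R n) c).source)).clm_bundle_apply₂
    (F₃ := ℝ) (E₃ := Bundle.Trivial M ℝ) (hs a) (hs b)
  have h2 : ContMDiffOn (𝓡 n) 𝓘(ℝ, ℝ) ∞ (fun q =>
      metricAt g q (dChartSymm c (extChartAt (𝓡 n) c q) a)
        (dChartSymm c (extChartAt (𝓡 n) c q) b)) (chartAt (R n) c).source := by
    intro q hq
    exact (Bundle.contMDiffWithinAt_totalSpace.1 (h q hq)).2
  refine (ContMDiffOn.contDiffOn_comp_extChartAt_symm h2).congr fun u hu => ?_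
  simp only [chartMetric, Function.comp_apply, (extChartAt (𝓡 n) c).right_inv hu,
    ContinuousLinearMap.bilinearComp_apply]

theorem contDiffAt_chartRep {f : M → N} (hf : ContMDiff (𝓡 n) (𝓡 k) ∞ f) (c : M) (d : N)
    {u : R n} (hu : u ∈ (extChartAt (𝓡 n) c).target)
    (hd : f ((extChartAt (𝓡 n) c).symm u) ∈ (extChartAt (𝓡 k) d).source) :
    ContDiffAt ℝ ∞ (chartRep f c d : R n → R k) u := by
  rw [← contMDiffAt_iff_contDiffAt]
  rw [extChartAt_source] at hd
  refine (contMDiffAt_extChartAt' hd).comp u ?_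
  exact hf.contMDiffAt.comp u ((contMDiffOn_extChartAt_symm c).contMDiffAt
    ((isOpen_target c).mem_nhds hu))

theorem fderiv_chartRep {f : M → N} (hf : ContMDiff (𝓡 n) (𝓡 k) ∞ f) (c : M) (d : N)
    {u : R n} (hu : u ∈ (extChartAt (𝓡 n) c).target)
    (hd : f ((extChartAt (𝓡 n) c).symm u) ∈ (extChartAt (𝓡 k) d).source) :
    fderiv ℝ (chartRep f c d : R n → R k) u =
      (dChart d (f ((extChartAt (𝓡 n) c).symm u))).comp
        ((diff f ((extChartAt (𝓡 n) c).symm u)).comp (dChartSymm c u)) := by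
  rw [extChartAt_source] at hd
  have h1 : MDifferentiableAt 𝓘(ℝ, R n) (𝓡 n) (extChartAt (𝓡 n) c).symm u :=
    ((contMDiffOn_extChartAt_symm (n := ∞) c).contMDiffAt
    ((isOpen_target c).mem_nhds hu)).mdifferentiableAt (by simp)
  have h2 : MDifferentiableAt (𝓡 n) (𝓡 k) f ((extChartAt (𝓡 n) c).symm u) :=
    hf.contMDiffAt.mdifferentiableAt (by simp)
  have h3 : MDifferentiableAt (𝓡 k) 𝓘(ℝ, R k) (extChartAt (𝓡 k) d)
      (f ((extChartAt (𝓡 n) c).symm u)) := mdifferentiableAt_extChartAt hd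
  rw [← mfderiv_eq_fderiv, chartRep, mfderiv_comp u h3 (h2.comp u h1), mfderiv_comp u h2 h1]
  rfl

/-- A map to a normed space may be differentiated at `p` in the chart at `p`, whose differential at
`p` is the identity. -/
theorem mfderiv_eq_fderiv_comp_symm {F : Type*} [NormedAddCommGroup F] [NormedSpace ℝ F]
    {h : M → F} {p : M}
    (hh : DifferentiableAt ℝ (h ∘ (extChartAt (𝓡 n) p).symm) (extChartAt (𝓡 n) p p)) :
    (mfderiv (𝓡 n) 𝓘(ℝ, F) h p : R n →L[ℝ] F) =
      fderiv ℝ (h ∘ (extChartAt (𝓡 n) p).symm) (extChartAt (𝓡 n) p p) := by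
  have he : h =ᶠ[𝓝 p] (h ∘ (extChartAt (𝓡 n) p).symm) ∘ extChartAt (𝓡 n) p := by
    filter_upwards [extChartAt_source_mem_nhds (I := 𝓡 n) p] with q hq
    simp only [Function.comp_apply, (extChartAt (𝓡 n) p).left_inv hq]
  rw [he.mfderiv_eq, mfderiv_comp p hh.mdifferentiableAt
    (mdifferentiableAt_extChartAt (mem_chart_source _ p)), mfderiv_extChartAt_self]
  rw [mfderiv_eq_fderiv]
  rfl

end Charts

/-! ### The Lie derivative of a metric in coordinates -/

section LieDerivative

variable {E E' : Type*} [NormedAddCommGroup E] [NormedSpace ℝ E]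
  [NormedAddCommGroup E'] [NormedSpace ℝ E']

/-- The Lie derivative `(L_X G)(a, b)` at `u` of a field `G` of bilinear forms on a normed space,
along the vector field `X`. -/
def lieMetric (G : E → E →L[ℝ] E →L[ℝ] ℝ) (X : E → E) (u a b : E) : ℝ :=
  fderiv ℝ G u (X u) a b + G u (fderiv ℝ X u a) b + G u a (fderiv ℝ X u b)

theorem hasFDerivAt_apply_apply {G : E → E' →L[ℝ] E' →L[ℝ] ℝ} {V W : E → E'} {u : E}
    (hG : DifferentiableAt ℝ G u) (hV : DifferentiableAt ℝ V u) (hW : DifferentiableAt ℝ W u)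
    (x : E) : fderiv ℝ (fun v => G v (V v) (W v)) u x =
      fderiv ℝ G u x (V u) (W u) + G u (fderiv ℝ V u x) (W u) + G u (V u) (fderiv ℝ W u x) := by
  rw [((hG.hasFDerivAt.clm_apply hV.hasFDerivAt).clm_apply hW.hasFDerivAt).fderiv]
  simp
  ring

theorem fderiv_apply_const {F : E → E →L[ℝ] E'} {u : E} (hF : DifferentiableAt ℝ F u)
    (x a : E) : fderiv ℝ (fun v => F v a) u x = fderiv ℝ F u x a := by
  rw [fderiv_clm_apply hF (differentiableAt_const a)]
  simp

theorem fderiv_apply_apply_const {G : E → E' →L[ℝ] E' →L[ℝ] ℝ} {u : E}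
    (hG : DifferentiableAt ℝ G u) (x : E) (a b : E') :
    fderiv ℝ (fun v => G v a b) u x = fderiv ℝ G u x a b := by
  rw [hasFDerivAt_apply_apply hG (differentiableAt_const a) (differentiableAt_const b)]
  simp

/-- The derivative of a pulled-back bilinear form. -/
theorem fderiv_pullback {F : E → E'} {G : E → E →L[ℝ] E →L[ℝ] ℝ}
    {G' : E' → E' →L[ℝ] E' →L[ℝ] ℝ} {u : E} (hF : ContDiffAt ℝ 2 F u)
    (hG : DifferentiableAt ℝ G u) (hG' : DifferentiableAt ℝ G' (F u))
    (h : ∀ᶠ v in 𝓝 u, ∀ a b, G v a b = G' (F v) (fderiv ℝ F v a) (fderiv ℝ F v b)) (x a b : E) :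
    fderiv ℝ G u x a b =
      fderiv ℝ G' (F u) (fderiv ℝ F u x) (fderiv ℝ F u a) (fderiv ℝ F u b) +
      G' (F u) (fderiv ℝ (fderiv ℝ F) u x a) (fderiv ℝ F u b) +
      G' (F u) (fderiv ℝ F u a) (fderiv ℝ (fderiv ℝ F) u x b) := by
  have hF1 : DifferentiableAt ℝ F u := hF.differentiableAt (by simp)
  have hF2 : DifferentiableAt ℝ (fderiv ℝ F) u :=
    (hF.fderiv_right (m := 1) (by norm_num)).differentiableAt (by simp)
  have hc : fderiv ℝ (fun v => G' (F v)) u x = fderiv ℝ G' (F u) (fderiv ℝ F u x) := 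
    DFunLike.congr_fun (fderiv_comp (g := G') u hG' hF1) _
  rw [← fderiv_apply_apply_const hG, Filter.EventuallyEq.fderiv_eq (h.mono fun v hv => hv a b),
    hasFDerivAt_apply_apply (DifferentiableAt.fun_comp' (g := G') u hG' hF1)
      (hF2.clm_apply (differentiableAt_const a)) (hF2.clm_apply (differentiableAt_const b)),
    fderiv_apply_const hF2, fderiv_apply_const hF2, hc]

/-- The Lie derivative of a metric is invariant under local isometries that relate the vector
fields. -/
theorem lieMetric_pullback {F : E → E'} {G : E → E →L[ℝ] E →L[ℝ] ℝ}
    {G' : E' → E' →L[ℝ] E' →L[ℝ] ℝ} {X : E → E} {X' : E' → E'} {u : E}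
    (hF : ContDiffAt ℝ 2 F u)
    (hG : DifferentiableAt ℝ G u) (hG' : DifferentiableAt ℝ G' (F u))
    (hX : DifferentiableAt ℝ X u) (hX' : DifferentiableAt ℝ X' (F u))
    (h : ∀ᶠ v in 𝓝 u, ∀ a b, G v a b = G' (F v) (fderiv ℝ F v a) (fderiv ℝ F v b))
    (hXX' : ∀ᶠ v in 𝓝 u, X' (F v) = fderiv ℝ F v (X v)) (a b : E) :
    lieMetric G X u a b = lieMetric G' X' (F u) (fderiv ℝ F u a) (fderiv ℝ F u b) := by
  have hF1 : DifferentiableAt ℝ F u := hF.differentiableAt (by simp)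
  have hF2 : DifferentiableAt ℝ (fderiv ℝ F) u :=
    (hF.fderiv_right (m := 1) (by norm_num)).differentiableAt (by simp)
  have hs : IsSymmSndFDerivAt ℝ F u := hF.isSymmSndFDerivAt (by simp)
  have hD : ∀ c, fderiv ℝ X' (F u) (fderiv ℝ F u c) =
      fderiv ℝ (fderiv ℝ F) u (X u) c + fderiv ℝ F u (fderiv ℝ X u c) := by
    intro c
    have h1 : fderiv ℝ (fun v => X' (F v)) u c = fderiv ℝ X' (F u) (fderiv ℝ F u c) := 
      DFunLike.congr_fun (fderiv_comp u hX' hF1) _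
    rw [← h1, Filter.EventuallyEq.fderiv_eq hXX', fderiv_clm_apply hF2 hX]
    simp [hs.eq c (X u), add_comm]
  rw [lieMetric, lieMetric, hD, hD, fderiv_pullback hF hG hG' h, h.self_of_nhds, h.self_of_nhds,
    hXX'.self_of_nhds]
  simp only [map_add, add_apply]
  ring

/-- Let `T` be the tangential part of the vector field `ξ` along an isometric immersion `F`, and let
`ν = ξ - dF(T)`. If the Lie derivative of `G'` along `ξ` vanishes, then half of the Lie derivative
of `G` along `T` is the inner product of `ν` with the second derivative of `F`, corrected by the
Christoffel symbols of `G'`. -/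
theorem lieMetric_tangentPart {F : E → E'} {G : E → E →L[ℝ] E →L[ℝ] ℝ}
    {G' : E' → E' →L[ℝ] E' →L[ℝ] ℝ} {T : E → E} {ξ : E' → E'} {u : E}
    (hF : ContDiffAt ℝ 2 F u)
    (hG : DifferentiableAt ℝ G u) (hG' : DifferentiableAt ℝ G' (F u))
    (hT : DifferentiableAt ℝ T u) (hξ : DifferentiableAt ℝ ξ (F u))
    (hsymm : ∀ᶠ y in 𝓝 (F u), ∀ a b, G' y a b = G' y b a)
    (h : ∀ᶠ v in 𝓝 u, ∀ a b, G v a b = G' (F v) (fderiv ℝ F v a) (fderiv ℝ F v b))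
    (hTξ : ∀ᶠ v in 𝓝 u, ∀ b, G v (T v) b = G' (F v) (ξ (F v)) (fderiv ℝ F v b))
    (a : E) (hkill : lieMetric G' ξ (F u) (fderiv ℝ F u a) (fderiv ℝ F u a) = 0) :
    lieMetric G T u a a / 2 =
      G' (F u) (ξ (F u) - fderiv ℝ F u (T u)) (fderiv ℝ (fderiv ℝ F) u a a) +
      fderiv ℝ G' (F u) (fderiv ℝ F u a) (fderiv ℝ F u a) (ξ (F u) - fderiv ℝ F u (T u)) -
      fderiv ℝ G' (F u) (ξ (F u) - fderiv ℝ F u (T u)) (fderiv ℝ F u a) (fderiv ℝ F u a) / 2 := by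
  have hF1 : DifferentiableAt ℝ F u := hF.differentiableAt (by simp)
  have hF2 : DifferentiableAt ℝ (fderiv ℝ F) u :=
    (hF.fderiv_right (m := 1) (by norm_num)).differentiableAt (by simp)
  have hs : fderiv ℝ (fderiv ℝ F) u a (T u) = fderiv ℝ (fderiv ℝ F) u (T u) a :=
    (hF.isSymmSndFDerivAt (by simp)).eq a (T u)
  have hsG' := hsymm.self_of_nhds
  have hsdG' : ∀ x a b, fderiv ℝ G' (F u) x a b = fderiv ℝ G' (F u) x b a := by
    intro x a b
    rw [← fderiv_apply_apply_const hG', ← fderiv_apply_apply_const hG',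
      Filter.EventuallyEq.fderiv_eq (hsymm.mono fun v hv => hv a b)]
  -- the derivative in the direction `a` of the equation that defines `T`
  have hD := DFunLike.congr_fun
    (Filter.EventuallyEq.fderiv_eq (𝕜 := ℝ) (hTξ.mono fun v hv => hv a)) a
  have hc : fderiv ℝ (fun v => G' (F v)) u a = fderiv ℝ G' (F u) (fderiv ℝ F u a) := 
    DFunLike.congr_fun (fderiv_comp (g := G') u hG' hF1) _
  have hc' : fderiv ℝ (fun v => ξ (F v)) u a = fderiv ℝ ξ (F u) (fderiv ℝ F u a) := 
    DFunLike.congr_fun (fderiv_comp u hξ hF1) _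
  rw [hasFDerivAt_apply_apply hG hT (differentiableAt_const a),
    hasFDerivAt_apply_apply (DifferentiableAt.fun_comp' (g := G') u hG' hF1)
      (DifferentiableAt.fun_comp' (g := ξ) u hξ hF1)
      (hF2.clm_apply (differentiableAt_const a)), fderiv_apply_const hF2, hc, hc',
    fderiv_pullback hF hG hG' h a] at hD
  simp only [fderiv_fun_const, Pi.zero_apply, zero_apply, map_zero,
    add_zero] at hD
  have hGs : G u a (fderiv ℝ T u a) = G u (fderiv ℝ T u a) a := by
    rw [h.self_of_nhds, h.self_of_nhds, hsG']
  rw [lieMetric] at hkill ⊢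
  rw [fderiv_pullback hF hG hG' h (T u), hGs]
  simp only [map_sub, sub_apply]
  have e1 := hsG' (fderiv ℝ F u a) (fderiv ℝ ξ (F u) (fderiv ℝ F u a))
  have e2 := hsG' (fderiv ℝ F u a) (fderiv ℝ (fderiv ℝ F) u (T u) a)
  have e3 := hsdG' (fderiv ℝ F u a) (fderiv ℝ F u a) (ξ (F u))
  have e4 := hsdG' (fderiv ℝ F u a) (fderiv ℝ F u a) (fderiv ℝ F u (T u))
  rw [hs] at hD
  linarith

end LieDerivative

/-! ### Linear algebra of a Riemannian metric at a point -/

section Pointwise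

variable {n : ℕ} {M : Type*} [TopologicalSpace M] [ChartedSpace (R n) M] [IsManifold (𝓡 n) ∞ M]

theorem metricAt_symm (g : Metric n M) (x : M) (v w : R n) :
    metricAt g x v w = metricAt g x w v := g.symm x v w

theorem metricAt_pos (g : Metric n M) (x : M) {v : R n} (hv : v ≠ 0) : 0 < metricAt g x v v :=
  g.pos x v hv

theorem metricAt_ext (g : Metric n M) (x : M) {v w : R n}
    (h : ∀ b, metricAt g x v b = metricAt g x w b) : v = w :=
  (metricAt_bijective g x).1 (ContinuousLinearMap.ext h)

theorem sharp_add (g : Metric n M) (x : M) (φ ψ : R n →L[ℝ] ℝ) :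
    sharp g x (φ + ψ) = sharp g x φ + sharp g x ψ := map_add _ _ _

theorem sharp_smul (g : Metric n M) (x : M) (r : ℝ) (φ : R n →L[ℝ] ℝ) :
    sharp g x (r • φ) = r • sharp g x φ := map_smul _ _ _

theorem christoffel_add_left (g : Metric n M) (x : M) (a a' b : R n) :
    christoffel g x (a + a') b = christoffel g x a b + christoffel g x a' b := by
  refine metricAt_ext g x fun c => ?_
  simp only [map_add, add_apply, metricAt_christoffel]
  ring

theorem christoffel_smul_left (g : Metric n M) (x : M) (r : ℝ) (a b : R n) :
    christoffel g x (r • a) b = r • christoffel g x a b := by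
  refine metricAt_ext g x fun c => ?_
  simp only [map_smul, smul_apply, metricAt_christoffel, smul_eq_mul]
  ring

theorem christoffel_add_right (g : Metric n M) (x : M) (a b b' : R n) :
    christoffel g x a (b + b') = christoffel g x a b + christoffel g x a b' := by
  refine metricAt_ext g x fun c => ?_
  simp only [map_add, add_apply, metricAt_christoffel]
  ring

theorem christoffel_smul_right (g : Metric n M) (x : M) (r : ℝ) (a b : R n) :
    christoffel g x a (r • b) = r • christoffel g x a b := by
  refine metricAt_ext g x fun c => ?_
  simp only [map_smul, smul_apply, metricAt_christoffel, smul_eq_mul]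
  ring

/-- A positive definite symmetric bilinear form on `ℝⁿ` has an orthonormal basis. -/
theorem exists_orthonormal_basis (B : R n →L[ℝ] R n →L[ℝ] ℝ) (hs : ∀ v w, B v w = B w v)
    (hp : ∀ v, v ≠ 0 → 0 < B v v) :
    ∃ e : Module.Basis (Fin n) ℝ (R n), ∀ i j, B (e i) (e j) = if i = j then 1 else 0 := by
  let B' : LinearMap.BilinForm ℝ (R n) :=
    LinearMap.mk₂ ℝ (fun v w => B v w) (by simp) (by simp) (by simp) (by simp)
  obtain ⟨v, hv⟩ := LinearMap.BilinForm.exists_orthogonal_basis (B := B')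
    ⟨fun x y => by simpa [B'] using hs x y⟩
  have hpos : ∀ i, 0 < B (v i) (v i) := fun i => hp _ (v.ne_zero i)
  have hne : ∀ i, (√(B (v i) (v i)))⁻¹ ≠ 0 := fun i => inv_ne_zero (Real.sqrt_pos.2 (hpos i)).ne'
  -- normalize an orthogonal basis
  refine ⟨(v.unitsSMul fun i => Units.mk0 _ (hne i)).reindex
    (finCongr (finrank_euclideanSpace_fin (𝕜 := ℝ))), fun i j => ?_⟩
  rw [Module.Basis.reindex_apply, Module.Basis.reindex_apply, Module.Basis.unitsSMul_apply,
    Module.Basis.unitsSMul_apply]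
  simp only [Units.smul_def, Units.val_mk0, map_smul, smul_apply, smul_eq_mul]
  split_ifs with hij
  · subst hij
    have := Real.mul_self_sqrt (hpos ((finCongr finrank_euclideanSpace_fin).symm i)).le
    have h0 := hne ((finCongr finrank_euclideanSpace_fin).symm i)
    rw [Ne, inv_eq_zero] at h0
    field_simp
    rw [sq, this]
  · have : B (v ((finCongr finrank_euclideanSpace_fin).symm i))
        (v ((finCongr finrank_euclideanSpace_fin).symm j)) = 0 :=
      hv fun h => hij ((finCongr _).symm.injective h)
    rw [this]
    simp

theorem exists_metricAt_orthonormal_basis (g : Metric n M) (x : M) :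
    ∃ e : Module.Basis (Fin n) ℝ (R n),
      ∀ i j, metricAt g x (e i) (e j) = if i = j then 1 else 0 :=
  exists_orthonormal_basis _ (metricAt_symm g x) fun _ => metricAt_pos g x

end Pointwise

/-! ### Isometric immersions in charts -/

section Immersions

variable {n k : ℕ}
  {M : Type*} [TopologicalSpace M] [ChartedSpace (R n) M] [IsManifold (𝓡 n) ∞ M]
  {N : Type*} [TopologicalSpace N] [ChartedSpace (R k) N] [IsManifold (𝓡 k) ∞ N]

theorem chartMetric_apply (g : Metric n M) (c : M) (u a b : R n) :
    chartMetric g c u a b =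
      metricAt g ((extChartAt (𝓡 n) c).symm u) (dChartSymm c u a) (dChartSymm c u b) := rfl

theorem chartMetric_symm (g : Metric n M) (c : M) (u a b : R n) :
    chartMetric g c u a b = chartMetric g c u b a := metricAt_symm g _ _ _

theorem chartMetric_pos (g : Metric n M) (c : M) {u : R n}
    (hu : u ∈ (extChartAt (𝓡 n) c).target) {a : R n} (ha : a ≠ 0) :
    0 < chartMetric g c u a a := by
  refine metricAt_pos g _ fun h => ha ?_
  exact ((dChart_dChartSymm_apply c hu a).symm.trans (congrArg _ h)).trans (map_zero _)

theorem chartMetric_self (g : Metric n M) (c : M) :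
    chartMetric g c (extChartAt (𝓡 n) c c) = metricAt g c := by
  ext a b
  rw [chartMetric_apply, dChartSymm_self, extChartAt_to_inv]
  rfl

theorem chartField_self (X : (q : M) → TangentSpace (𝓡 n) q) (c : M) :
    chartField X c (extChartAt (𝓡 n) c c) = X c := by
  unfold chartField
  rw [extChartAt_to_inv, dChart_self]
  rfl

theorem differentiableAt_chartMetric (g : Metric n M) (c : M) {u : R n}
    (hu : u ∈ (extChartAt (𝓡 n) c).target) : DifferentiableAt ℝ (chartMetric g c) u :=
  ((contDiffOn_chartMetric g c).contDiffAt ((isOpen_target c).mem_nhds hu)).differentiableAt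
    (by simp)

/-- Two tangent vectors with the same components pair with the metric as their components do. -/
theorem chartMetric_dChart (g : Metric n M) (c : M) {q : M}
    (hq : q ∈ (extChartAt (𝓡 n) c).source) (a b : R n) :
    chartMetric g c (extChartAt (𝓡 n) c q) (dChart c q a) (dChart c q b) = metricAt g q a b := by
  have h := dChartSymm_dChart_apply c ((extChartAt (𝓡 n) c).map_source hq)
  rw [(extChartAt (𝓡 n) c).left_inv hq] at h
  rw [chartMetric_apply, (extChartAt (𝓡 n) c).left_inv hq, h, h]

theorem dChartSymm_chartField (X : (q : M) → TangentSpace (𝓡 n) q) (c : M) {u : R n}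
    (hu : u ∈ (extChartAt (𝓡 n) c).target) :
    dChartSymm c u (chartField X c u) = X ((extChartAt (𝓡 n) c).symm u) :=
  dChartSymm_dChart_apply c hu _

/-- In coordinates, an isometric immersion pulls back the metric of `N` to the metric of `M`. -/
theorem chartMetric_pullback {gM : Metric n M} {gN : Metric k N} {f : M → N}
    (hf : IsIsometricImmersion gM gN f) (c : M) (d : N) {u : R n}
    (hu : u ∈ (extChartAt (𝓡 n) c).target)
    (hd : f ((extChartAt (𝓡 n) c).symm u) ∈ (extChartAt (𝓡 k) d).source) (a b : R n) :
    chartMetric gM c u a b = chartMetric gN d (chartRep f c d u)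
      (fderiv ℝ (chartRep f c d : R n → R k) u a) (fderiv ℝ (chartRep f c d : R n → R k) u b) := by
  rw [fderiv_chartRep hf.smooth c d hu hd, chartRep_apply]
  simp only [ContinuousLinearMap.comp_apply]
  rw [chartMetric_dChart gN d hd, hf.isometric, chartMetric_apply]

theorem isIsometricImmersion_id (g : Metric n M) :
    IsIsometricImmersion g g (fun q : M => q) where
  smooth := contMDiff_id
  isometric p v w := by
    rw [diff_id]
    rfl

/-- The components of a vector field change by the Jacobian matrix of the change of coordinates,
which is the coordinate expression of the identity map in two charts. -/
theorem chartField_chartRep_id (X : (q : M) → TangentSpace (𝓡 n) q) (c d : M) {u : R n}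
    (hu : u ∈ (extChartAt (𝓡 n) c).target)
    (hd : (extChartAt (𝓡 n) c).symm u ∈ (extChartAt (𝓡 n) d).source) :
    chartField X d (chartRep (fun q : M => q) c d u) =
      fderiv ℝ (chartRep (fun q : M => q) c d : R n → R n) u (chartField X c u) := by
  rw [fderiv_chartRep (f := fun q : M => q) contMDiff_id c d hu hd, chartRep_apply,
    chartField_extChartAt X d hd, diff_id,
    ContinuousLinearMap.id_comp, ContinuousLinearMap.comp_apply]
  exact congrArg _ (dChartSymm_chartField X c hu).symm

/-- The tangential part `ξ^⊤` of a vector field `ξ` along `f`, as a vector field on `M`. -/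
def tangentField (gM : Metric n M) (gN : Metric k N) (f : M → N)
    (ξ : (y : N) → TangentSpace (𝓡 k) y) (q : M) : TangentSpace (𝓡 n) q :=
  tangentPart gM gN f q (ξ (f q))

/-- The tangential part of a vector field, in coordinates. -/
theorem chartMetric_tangentPart {gM : Metric n M} {gN : Metric k N} {f : M → N}
    (hf : IsIsometricImmersion gM gN f) (ξ : (y : N) → TangentSpace (𝓡 k) y) (c : M) (d : N)
    {u : R n} (hu : u ∈ (extChartAt (𝓡 n) c).target)
    (hd : f ((extChartAt (𝓡 n) c).symm u) ∈ (extChartAt (𝓡 k) d).source) (b : R n) :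
    chartMetric gM c u (chartField (tangentField gM gN f ξ) c u) b =
      chartMetric gN d (chartRep f c d u) (chartField ξ d (chartRep f c d u))
        (fderiv ℝ (chartRep f c d : R n → R k) u b) := by
  rw [chartMetric_apply]
  refine (congrArg (fun w => metricAt gM _ w _) (dChartSymm_chartField _ c hu)).trans ?_
  refine (metricAt_sharp gM _ _ _).trans ?_
  rw [fderiv_chartRep hf.smooth c d hu hd, chartRep_apply, chartField_extChartAt ξ d hd]
  exact (chartMetric_dChart gN d hd _ _).symm

/-- The tangential part of a smooth vector field is smooth: its components are obtained by applying
the inverse of the metric, which is a smooth function of the coordinates. -/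
theorem contDiffOn_chartField_tangentPart {gM : Metric n M} {gN : Metric k N} {f : M → N}
    (hf : IsIsometricImmersion gM gN f) {ξ : (y : N) → TangentSpace (𝓡 k) y}
    (hξ : ContMDiff (𝓡 k) (𝓡 k).tangent ∞ (fun y => (⟨y, ξ y⟩ : TangentBundle (𝓡 k) N)))
    (c : M) :
    ContDiffOn ℝ ∞ (chartField (tangentField gM gN f ξ) c)
      (extChartAt (𝓡 n) c).target := by
  intro u hu
  set d := f ((extChartAt (𝓡 n) c).symm u) with hd'
  have hd : f ((extChartAt (𝓡 n) c).symm u) ∈ (extChartAt (𝓡 k) d).source :=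
    mem_extChartAt_source d
  have hF : ContDiffAt ℝ ∞ (chartRep f c d : R n → R k) u := contDiffAt_chartRep hf.smooth c d hu hd
  have hFu : (chartRep f c d u : R k) ∈ (extChartAt (𝓡 k) d).target :=
    (extChartAt (𝓡 k) d).map_source hd
  have hG := (contDiffOn_chartMetric gM c).contDiffAt ((isOpen_target c).mem_nhds hu)
  have hG' := ((contDiffOn_chartMetric gN d).contDiffAt ((isOpen_target d).mem_nhds hFu)).comp u hF
  have hX' := ((contDiffOn_chartField hξ d).contDiffAt ((isOpen_target d).mem_nhds hFu)).comp u hF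
  have hL := (hG'.clm_apply hX').clm_comp (hF.fderiv_right (m := ∞) (by simp))
  have : FiniteDimensional ℝ (R n →L[ℝ] ℝ) :=
    (LinearMap.toContinuousLinearMap : (R n →ₗ[ℝ] ℝ) ≃ₗ[ℝ] (R n →L[ℝ] ℝ)).finiteDimensional
  have hdim : Module.finrank ℝ (R n) = Module.finrank ℝ (R n →L[ℝ] ℝ) := by
    rw [← (LinearMap.toContinuousLinearMap : (R n →ₗ[ℝ] ℝ) ≃ₗ[ℝ] (R n →L[ℝ] ℝ)).finrank_eq]
    exact (Subspace.dual_finrank_eq (K := ℝ) (V := R n)).symm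
  have hequiv : ∀ v ∈ (extChartAt (𝓡 n) c).target,
      ∃ e : R n ≃L[ℝ] (R n →L[ℝ] ℝ), chartMetric gM c v = (e : R n →L[ℝ] (R n →L[ℝ] ℝ)) := by
    intro v hv
    have hinj : Function.Injective (chartMetric gM c v) := by
      rw [injective_iff_map_eq_zero]
      intro a ha
      by_contra hne
      have h1 := chartMetric_pos gM c hv hne
      rw [ha] at h1
      simp at h1
    exact ⟨(LinearEquiv.ofInjectiveOfFinrankEq (chartMetric gM c v).toLinearMap hinj
      hdim).toContinuousLinearEquiv, by ext; rfl⟩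
  obtain ⟨e, he⟩ := hequiv u hu
  have hinv : ContDiffAt ℝ ∞ (fun v => (chartMetric gM c v).inverse) u := by
    refine ContDiffAt.comp (g := ContinuousLinearMap.inverse) u ?_ hG
    rw [he]
    exact contDiffAt_map_inverse e
  refine ((hinv.clm_apply hL).congr_of_eventuallyEq ?_).contDiffWithinAt
  filter_upwards [eventually_mem_chartRep_domain hf.smooth.continuous c d hu hd] with v hv
  obtain ⟨e', he'⟩ := hequiv v hv.1
  have h2 : chartMetric gM c v (chartField (tangentField gM gN f ξ) c v) =
      (chartMetric gN d (chartRep f c d v) (chartField ξ d (chartRep f c d v))).comp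
        (fderiv ℝ (chartRep f c d : R n → R k) v) :=
    ContinuousLinearMap.ext fun b => chartMetric_tangentPart hf ξ c d hv.1 hv.2 b
  simp only [Function.comp_apply]
  rw [← h2, he', ContinuousLinearMap.inverse_equiv]
  exact (e'.symm_apply_apply _).symm

end Immersions

/-! ### Covariant derivatives, divergence and second fundamental form in charts -/

section Divergence

variable {n : ℕ} {M : Type*} [TopologicalSpace M] [ChartedSpace (R n) M] [IsManifold (𝓡 n) ∞ M]

/-- The covariant derivative in the chart at `p`. The value of `X` at `p` is written as the vector
of its components, which it is by definition (`chartField_self`). -/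
theorem covDeriv_eq (g : Metric n M) {X : (q : M) → TangentSpace (𝓡 n) q} {p : M}
    (hX : DifferentiableAt ℝ (chartField X p) (extChartAt (𝓡 n) p p)) (v : R n) :
    covDeriv g X p v = fderiv ℝ (chartField X p) (extChartAt (𝓡 n) p p) v +
      christoffel g p v (chartField X p (extChartAt (𝓡 n) p p)) := by
  have h : componentDeriv (fun q : M => q) X p =
      fderiv ℝ (chartField X p) (extChartAt (𝓡 n) p p) :=
    mfderiv_eq_fderiv_comp_symm (h := fun q => dChart p q (X q)) hX
  unfold covDeriv covDerivAlong
  rw [h, diff_id, chartField_self]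
  rfl

theorem dMetric_symm (g : Metric n M) (p : M) (a b c : R n) :
    dMetric g p a b c = dMetric g p a c b := by
  have hG := differentiableAt_chartMetric g p (mem_extChartAt_target (I := 𝓡 n) p)
  rw [dMetric, ← fderiv_apply_apply_const hG, ← fderiv_apply_apply_const hG]
  simp_rw [chartMetric_symm g p _ b c]

/-- The symmetrized covariant derivative of a vector field `X` is the Lie derivative of the metric
along `X`: the Christoffel symbols disappear. -/
theorem metricAt_covDeriv_add (g : Metric n M) {X : (q : M) → TangentSpace (𝓡 n) q} {p : M}
    (hX : DifferentiableAt ℝ (chartField X p) (extChartAt (𝓡 n) p p)) (v w : R n) :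
    metricAt g p (covDeriv g X p v) w + metricAt g p v (covDeriv g X p w) =
      lieMetric (chartMetric g p) (chartField X p) (extChartAt (𝓡 n) p p) v w := by
  rw [covDeriv_eq g hX, covDeriv_eq g hX, lieMetric, chartMetric_self]
  generalize chartField X p (extChartAt (𝓡 n) p p) = x
  simp only [map_add, add_apply]
  rw [metricAt_symm g p v (christoffel g p w x), metricAt_christoffel, metricAt_christoffel]
  have h1 := dMetric_symm g p v x w
  have h2 := dMetric_symm g p w x v
  have h3 := dMetric_symm g p x v w
  change _ = dMetric g p x v w + _ + _
  linarith

/-- The divergence of `X` is half of the trace of `L_X g`. -/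
theorem divergence_eq_sum (g : Metric n M) {X : (q : M) → TangentSpace (𝓡 n) q} {p : M}
    (hX : DifferentiableAt ℝ (chartField X p) (extChartAt (𝓡 n) p p))
    (e : Module.Basis (Fin n) ℝ (R n))
    (he : ∀ i j, metricAt g p (e i) (e j) = if i = j then 1 else 0) :
    divergence g X p = ∑ i, lieMetric (chartMetric g p) (chartField X p)
      (extChartAt (𝓡 n) p p) (e i) (e i) / 2 := by
  have hadd : ∀ v w, covDeriv g X p (v + w) = covDeriv g X p v + covDeriv g X p w := by
    intro v w
    simp only [covDeriv_eq g hX, map_add, christoffel_add_left]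
    abel
  have hsmul : ∀ (r : ℝ) v, covDeriv g X p (r • v) = r • covDeriv g X p v := by
    intro r v
    simp only [covDeriv_eq g hX, map_smul, christoffel_smul_left, smul_add]
  let B : R n →ₗ[ℝ] R n →ₗ[ℝ] ℝ :=
    LinearMap.mk₂ ℝ (fun v w => metricAt g p (covDeriv g X p v) w)
      (fun v v' w => by rw [hadd, map_add, add_apply])
      (fun r v w => by rw [hsmul, map_smul, smul_apply])
      (fun v w w' => map_add _ _ _) (fun r v w => map_smul _ _ _)
  refine (metricTrace_eq_sum g p B e he).trans (Finset.sum_congr rfl fun i _ => ?_)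
  rw [← metricAt_covDeriv_add g hX, metricAt_symm g p (e i)]
  simp [B]

end Divergence

section SecondFundamentalForm

variable {n k : ℕ}
  {M : Type*} [TopologicalSpace M] [ChartedSpace (R n) M] [IsManifold (𝓡 n) ∞ M]
  {N : Type*} [TopologicalSpace N] [ChartedSpace (R k) N] [IsManifold (𝓡 k) ∞ N]
  {gM : Metric n M} {gN : Metric k N} {f : M → N}

theorem normalPart_add (p : M) (W W' : R k) :
    normalPart gM gN f p (W + W') = normalPart gM gN f p W + normalPart gM gN f p W' := by
  simp only [normalPart, tangentPart, map_add, ContinuousLinearMap.add_comp, sharp_add]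
  abel

theorem normalPart_smul (p : M) (r : ℝ) (W : R k) :
    normalPart gM gN f p (r • W) = r • normalPart gM gN f p W := by
  simp only [normalPart, tangentPart, map_smul, ContinuousLinearMap.smul_comp, sharp_smul, smul_sub]

theorem metricAt_normalPart_normalPart (hf : IsIsometricImmersion gM gN f) (p : M) (W W' : R k) :
    metricAt gN (f p) (normalPart gM gN f p W) (normalPart gM gN f p W') =
      metricAt gN (f p) (normalPart gM gN f p W) W' := by
  conv_lhs => rw [normalPart.eq_def gM gN f p W', map_sub, normalPart_orthogonal gM gN f hf,
    sub_zero]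

theorem fderiv_chartRep_self (hf : ContMDiff (𝓡 n) (𝓡 k) ∞ f) (p : M) :
    fderiv ℝ (chartRep f p (f p) : R n → R k) (extChartAt (𝓡 n) p p) = diff f p := by
  have h := fderiv_chartRep hf p (f p) (mem_extChartAt_target (I := 𝓡 n) p)
    (by rw [extChartAt_to_inv]; exact mem_extChartAt_source (f p))
  rw [extChartAt_to_inv, dChart_self, dChartSymm_self] at h
  exact h

/-- The second fundamental form is the normal part of the second derivative of the coordinate
expression of `f`, corrected by the Christoffel symbols of `N`. -/
theorem secondFundamentalForm_eq (hf : ContMDiff (𝓡 n) (𝓡 k) ∞ f) (p : M) (v w : R n) :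
    secondFundamentalForm gM gN f p v w = normalPart gM gN f p
      (fderiv ℝ (fderiv ℝ (chartRep f p (f p) : R n → R k)) (extChartAt (𝓡 n) p p) v w +
        christoffel gN (f p) (diff f p v) (diff f p w)) := by
  have hu := mem_extChartAt_target (I := 𝓡 n) p
  have hd : f ((extChartAt (𝓡 n) p).symm (extChartAt (𝓡 n) p p)) ∈
      (extChartAt (𝓡 k) (f p)).source := by
    rw [extChartAt_to_inv]; exact mem_extChartAt_source (f p)
  have hF := contDiffAt_chartRep hf p (f p) hu hd
  have hF2 : DifferentiableAt ℝ (fderiv ℝ (chartRep f p (f p) : R n → R k))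
      (extChartAt (𝓡 n) p p) :=
    (hF.fderiv_right (m := ∞) (by simp)).differentiableAt (by simp)
  -- the field `df(Y)`, for `Y` with constant components `w`, has the components `dF(w)`
  have heq : (fun q => dChart (f p) (f q) (diff f q (constField p w q))) ∘
      (extChartAt (𝓡 n) p).symm =ᶠ[𝓝 (extChartAt (𝓡 n) p p)]
        fun u => fderiv ℝ (chartRep f p (f p) : R n → R k) u w := by
    filter_upwards [eventually_mem_chartRep_domain hf.continuous p (f p) hu hd] with u hu
    rw [fderiv_chartRep hf p (f p) hu.1 hu.2]
    simp only [Function.comp_apply, constField, (extChartAt (𝓡 n) p).right_inv hu.1,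
      ContinuousLinearMap.comp_apply]
  have hc : componentDeriv f (fun q => diff f q (constField p w q)) p v =
      fderiv ℝ (fderiv ℝ (chartRep f p (f p) : R n → R k)) (extChartAt (𝓡 n) p p) v w := by
    have h := mfderiv_eq_fderiv_comp_symm
      (h := fun q => dChart (f p) (f q) (diff f q (constField p w q)))
      (heq.differentiableAt_iff.2 (hF2.clm_apply (differentiableAt_const w)))
    rw [← fderiv_apply_const hF2, ← heq.fderiv_eq]
    exact DFunLike.congr_fun h v
  have hw : (diff f p (constField p w p) : R k) = diff f p w := by
    unfold constField
    rw [dChartSymm_self]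
    rfl
  exact congrArg₂ (fun a b : R k => normalPart gM gN f p
    (a + christoffel gN (f p) (diff f p v) b)) hc hw

theorem meanCurvature_eq_sum (hf : ContMDiff (𝓡 n) (𝓡 k) ∞ f) (p : M)
    (e : Module.Basis (Fin n) ℝ (R n))
    (he : ∀ i j, metricAt gM p (e i) (e j) = if i = j then 1 else 0) :
    meanCurvature gM gN f p = ∑ i, secondFundamentalForm gM gN f p (e i) (e i) := by
  let B : R n →ₗ[ℝ] R n →ₗ[ℝ] R k :=
    LinearMap.mk₂ ℝ (secondFundamentalForm gM gN f p)
      (fun v v' w => by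
        simp only [secondFundamentalForm_eq hf, ← normalPart_add, map_add, christoffel_add_left,
          add_apply]
        congr 1; abel)
      (fun r v w => by
        simp only [secondFundamentalForm_eq hf, ← normalPart_smul, map_smul, christoffel_smul_left,
          smul_apply, smul_add])
      (fun v w w' => by
        simp only [secondFundamentalForm_eq hf, ← normalPart_add, map_add, christoffel_add_right]
        congr 1; abel)
      (fun r v w => by
        simp only [secondFundamentalForm_eq hf, ← normalPart_smul, map_smul,
          christoffel_smul_right, smul_add])
  exact metricTrace_eq_sum gM p B e he

/-- For a Killing field `ξ`, the symmetrized covariant derivative of `ξ^⊤` is the second fundamental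
form in the direction of `ξ^⊥`. -/
theorem lieMetric_tangentField (hf : IsIsometricImmersion gM gN f)
    {ξ : (y : N) → TangentSpace (𝓡 k) y} (hξ : IsKilling gN ξ) (p : M) (a : R n) :
    lieMetric (chartMetric gM p) (chartField (tangentField gM gN f ξ) p) (extChartAt (𝓡 n) p p)
      a a / 2 =
      metricAt gN (f p)
        (normalPart gM gN f p (chartField ξ (f p) (extChartAt (𝓡 k) (f p) (f p))))
        (secondFundamentalForm gM gN f p a a) := by
  have hu := mem_extChartAt_target (I := 𝓡 n) p
  have hd : f ((extChartAt (𝓡 n) p).symm (extChartAt (𝓡 n) p p)) ∈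
      (extChartAt (𝓡 k) (f p)).source := by
    rw [extChartAt_to_inv]; exact mem_extChartAt_source (f p)
  have hev := eventually_mem_chartRep_domain hf.smooth.continuous p (f p) hu hd
  have hF : ContDiffAt ℝ 2 (chartRep f p (f p) : R n → R k) (extChartAt (𝓡 n) p p) :=
    (contDiffAt_chartRep hf.smooth p (f p) hu hd).of_le (WithTop.coe_le_coe.2 le_top)
  have hu' := mem_extChartAt_target (I := 𝓡 k) (f p)
  have hξd : DifferentiableAt ℝ (chartField ξ (f p)) (extChartAt (𝓡 k) (f p) (f p)) :=
    ((contDiffOn_chartField hξ.smooth (f p)).contDiffAt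
      ((isOpen_target (f p)).mem_nhds hu')).differentiableAt (by simp)
  have hT : DifferentiableAt ℝ (chartField (tangentField gM gN f ξ) p) (extChartAt (𝓡 n) p p) :=
    ((contDiffOn_chartField_tangentPart hf hξ.smooth p).contDiffAt
      ((isOpen_target p).mem_nhds hu)).differentiableAt (by simp)
  have h := lieMetric_tangentPart (ξ := chartField ξ (f p)) hF
    (differentiableAt_chartMetric gM p hu)
    (by rw [chartRep_self]; exact differentiableAt_chartMetric gN (f p) hu') hT
    (by rw [chartRep_self]; exact hξd)
    (Eventually.of_forall fun y => chartMetric_symm gN (f p) y)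
    (hev.mono fun u hu => chartMetric_pullback hf p (f p) hu.1 hu.2)
    (hev.mono fun u hu => chartMetric_tangentPart hf ξ p (f p) hu.1 hu.2) a
    (by
      rw [chartRep_self, ← metricAt_covDeriv_add gN hξd]
      exact hξ.killing _ _ _)
  have hν : chartField (tangentField gM gN f ξ) p (extChartAt (𝓡 n) p p) =
      tangentPart gM gN f p (chartField ξ (f p) (extChartAt (𝓡 k) (f p) (f p))) := by
    rw [chartField_self, chartField_self]
    rfl
  rw [h, secondFundamentalForm_eq hf.smooth, metricAt_normalPart_normalPart hf, chartRep_self,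
    chartMetric_self, hν, fderiv_chartRep_self hf.smooth, map_add, ← normalPart,
    metricAt_symm gN (f p) _ (christoffel _ _ _ _), metricAt_christoffel]
  change _ + dMetric gN (f p) _ _ _ - dMetric gN (f p) _ _ _ / 2 = _
  ring

/-- The divergence formula for solitons: the trace of `⟨ξ^⊥, A⟩` is `⟨ξ^⊥, H⟩ = ⟨H, H⟩`. -/
theorem divergence_tangentField {ξ : (y : N) → TangentSpace (𝓡 k) y} (hξ : IsKilling gN ξ)
    (hf : IsSoliton gM gN f ξ) (p : M) :
    divergence gM (tangentField gM gN f ξ) p =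
      metricAt gN (f p) (meanCurvature gM gN f p) (meanCurvature gM gN f p) := by
  obtain ⟨e, he⟩ := exists_metricAt_orthonormal_basis gM p
  have hT : DifferentiableAt ℝ (chartField (tangentField gM gN f ξ) p) (extChartAt (𝓡 n) p p) :=
    ((contDiffOn_chartField_tangentPart hf.immersion hξ.smooth p).contDiffAt
      ((isOpen_target p).mem_nhds (mem_extChartAt_target p))).differentiableAt (by simp)
  rw [divergence_eq_sum gM hT e he]
  have hH : normalPart gM gN f p (chartField ξ (f p) (extChartAt (𝓡 k) (f p) (f p))) =
      meanCurvature gM gN f p := by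
    rw [hf.soliton p, chartField_self]
  simp only [lieMetric_tangentField hf.immersion hξ, ← map_sum, hH]
  rw [← meanCurvature_eq_sum hf.immersion.smooth p e he]

end SecondFundamentalForm

/-! ### Gram determinants -/

section GramMatrix

variable {n : ℕ}

/-- The matrix of a bilinear form in the standard basis of `ℝⁿ`. -/
def gram (B : R n →L[ℝ] R n →L[ℝ] ℝ) : Matrix (Fin n) (Fin n) ℝ :=
  Matrix.of fun i j => B (EuclideanSpace.single i 1) (EuclideanSpace.single j 1)

theorem eq_sum_smul_single (w : R n) : w = ∑ i, w i • EuclideanSpace.single i (1 : ℝ) := by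
  ext j
  simp [Pi.single_apply]

theorem det_gram_bilinearComp (B : R n →L[ℝ] R n →L[ℝ] ℝ) (A : R n →L[ℝ] R n) :
    (gram (B.bilinearComp A A)).det = A.det ^ 2 * (gram B).det := by
  let b := (EuclideanSpace.basisFun (Fin n) ℝ).toBasis
  let P := LinearMap.toMatrix b b (A : R n →ₗ[ℝ] R n)
  have hP : ∀ i j, P i j = A (EuclideanSpace.single j 1) i := by
    intro i j
    simp [P, b, LinearMap.toMatrix_apply]
  have hmul : gram (B.bilinearComp A A) = P.transpose * gram B * P := by
    ext i j
    simp only [gram, Matrix.of_apply, ContinuousLinearMap.bilinearComp_apply, Matrix.mul_apply,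
      Matrix.transpose_apply, hP]
    conv_lhs => rw [eq_sum_smul_single (A (EuclideanSpace.single j 1)),
      eq_sum_smul_single (A (EuclideanSpace.single i 1))]
    simp only [map_sum, map_smul, smul_eq_mul, sum_apply, smul_apply, Finset.sum_mul,
      Finset.mul_sum]
    refine Finset.sum_congr rfl fun a _ => Finset.sum_congr rfl fun c _ => ?_
    ring
  have hdet : P.det = A.det := LinearMap.det_toMatrix b _
  rw [hmul, Matrix.det_mul, Matrix.det_mul, Matrix.det_transpose, hdet]
  ring

/-- A basis that is orthonormal for `B`, as a linear map from the standard basis. -/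
theorem exists_gram_bilinearComp_eq_one {B : R n →L[ℝ] R n →L[ℝ] ℝ}
    (e : Module.Basis (Fin n) ℝ (R n)) (he : ∀ i j, B (e i) (e j) = if i = j then 1 else 0) :
    ∃ A : R n →L[ℝ] R n, (∀ i, A (EuclideanSpace.single i 1) = e i) ∧
      gram (B.bilinearComp A A) = 1 := by
  let b := (EuclideanSpace.basisFun (Fin n) ℝ).toBasis
  have hA : ∀ i, LinearMap.toContinuousLinearMap (b.constr ℝ e) (EuclideanSpace.single i 1) =
      e i := by
    intro i
    have : (EuclideanSpace.single i 1 : R n) = b i := by simp [b]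
    rw [this]
    exact b.constr_basis ℝ e i
  refine ⟨LinearMap.toContinuousLinearMap (b.constr ℝ e), hA, ?_⟩
  ext i j
  simp only [gram, Matrix.of_apply, ContinuousLinearMap.bilinearComp_apply, hA, he,
    Matrix.one_apply]

theorem det_gram_pos {B : R n →L[ℝ] R n →L[ℝ] ℝ} (hs : ∀ v w, B v w = B w v)
    (hp : ∀ v, v ≠ 0 → 0 < B v v) : 0 < (gram B).det := by
  obtain ⟨e, he⟩ := exists_orthonormal_basis B hs hp
  obtain ⟨A, -, hA⟩ := exists_gram_bilinearComp_eq_one e he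
  have h := det_gram_bilinearComp B A
  rw [hA, Matrix.det_one] at h
  by_contra hneg
  nlinarith [sq_nonneg A.det]

theorem contDiff_det : ContDiff ℝ ∞ (fun m : Fin n → Fin n → ℝ => (Matrix.of m).det) := by
  simp only [Matrix.det_apply, Matrix.of_apply]
  fun_prop

/-- The derivative of the determinant at the identity matrix is the trace. -/
theorem fderiv_det_of_eq_one {E : Type*} [NormedAddCommGroup E] [NormedSpace ℝ E]
    {m : E → Fin n → Fin n → ℝ} {u : E} (hm : DifferentiableAt ℝ m u)
    (h1 : Matrix.of (m u) = 1) (x : E) :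
    fderiv ℝ (fun v => (Matrix.of (m v)).det) u x = ∑ i, fderiv ℝ m u x i i := by
  have hD : DifferentiableAt ℝ (fun m : Fin n → Fin n → ℝ => (Matrix.of m).det) (m u) :=
    contDiff_det.contDiffAt.differentiableAt (by simp)
  have hc := DFunLike.congr_fun (fderiv_comp u hD hm) x
  refine hc.trans ?_
  rw [ContinuousLinearMap.comp_apply]
  set a := fderiv ℝ m u x
  -- the derivative of `det` at `1` in the direction `a` is computed along the line `1 + t a`
  have hline : HasDerivAt (fun t : ℝ => m u + t • a) a 0 := by
    simpa using ((hasDerivAt_id (0 : ℝ)).smul_const a).const_add (m u)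
  have hD0 : HasFDerivAt (fun m : Fin n → Fin n → ℝ => (Matrix.of m).det)
      (fderiv ℝ (fun m : Fin n → Fin n → ℝ => (Matrix.of m).det) (m u)) (m u + (0 : ℝ) • a) := by
    simpa using hD.hasFDerivAt
  have h2 := hD0.comp_hasDerivAt (0 : ℝ) hline
  have h3 : HasDerivAt (fun t : ℝ => (Matrix.of (m u + t • a)).det) (Matrix.of a).trace 0 := by
    have heq : (fun t : ℝ => (Matrix.of (m u + t • a)).det) = fun t : ℝ =>
        1 + (Matrix.of a).trace * t +
          ((Matrix.det (1 + (Polynomial.X : Polynomial ℝ) •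
            (Matrix.of a).map Polynomial.C)).divX.divX.eval t) * t ^ 2 := by
      funext t
      rw [← Matrix.det_one_add_smul, ← h1]
      rfl
    rw [heq]
    have hq := (Matrix.det (1 + (Polynomial.X : Polynomial ℝ) •
      (Matrix.of a).map Polynomial.C)).divX.divX.hasDerivAt (0 : ℝ)
    have h4 := (((hasDerivAt_id (0 : ℝ)).const_mul (Matrix.of a).trace).const_add 1).add
      (hq.mul (hasDerivAt_pow 2 (0 : ℝ)))
    refine HasDerivAt.congr_deriv (f' := _) h4 ?_
    simp
  exact h2.unique h3

/-- The logarithmic derivative of `√det G` is half of the trace of the derivative of `G`. -/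
theorem fderiv_sqrt_det_gram {G : R n → R n →L[ℝ] R n →L[ℝ] ℝ} {u : R n}
    (hG : DifferentiableAt ℝ G u) (e : Module.Basis (Fin n) ℝ (R n))
    (he : ∀ i j, G u (e i) (e j) = if i = j then 1 else 0) (x : R n) :
    fderiv ℝ (fun v => √(gram (G v)).det) u x =
      √(gram (G u)).det * ∑ i, fderiv ℝ G u x (e i) (e i) / 2 := by
  -- in the basis `e` the Gram matrix of `G u` is the identity, and the Gram determinants in the
  -- two bases differ by the constant factor `A.det ^ 2`
  obtain ⟨A, hAe, hA⟩ := exists_gram_bilinearComp_eq_one e he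
  have hdet : A.det ^ 2 * (gram (G u)).det = 1 := by
    rw [← det_gram_bilinearComp, hA, Matrix.det_one]
  have hA0 : A.det ^ 2 ≠ 0 := left_ne_zero_of_mul_eq_one hdet
  have hentry : ∀ i j, DifferentiableAt ℝ (fun v => G v (e i) (e j)) u := fun i j =>
    (hG.clm_apply (differentiableAt_const _)).clm_apply (differentiableAt_const _)
  have hm : DifferentiableAt ℝ (fun v i j => G v (e i) (e j)) u :=
    differentiableAt_pi.2 fun i => differentiableAt_pi.2 fun j => hentry i j
  have hgram : ∀ v, A.det ^ 2 * (gram (G v)).det =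
      (Matrix.of (fun i j => G v (e i) (e j))).det := by
    intro v
    rw [← det_gram_bilinearComp]
    congr 1
    ext i j
    simp [gram, hAe]
  have h1 := fderiv_det_of_eq_one hm (by ext i j; simp [he, Matrix.one_apply]) x
  have h2 : ∀ i, fderiv ℝ (fun v i j => G v (e i) (e j)) u x i i =
      fderiv ℝ G u x (e i) (e i) := by
    intro i
    rw [← fderiv_apply_apply_const hG]
    rw [fderiv_pi (fun i => differentiableAt_pi.2 fun j => hentry i j)]
    simp only [ContinuousLinearMap.pi_apply]
    rw [fderiv_pi (fun j => hentry i j)]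
    rfl
  have hdd : DifferentiableAt ℝ (fun v => (gram (G v)).det) u :=
    DifferentiableAt.fun_comp' (g := fun m : Fin n → Fin n → ℝ => (Matrix.of m).det) u
      (contDiff_det.contDiffAt.differentiableAt (by simp))
      (differentiableAt_pi.2 fun i => differentiableAt_pi.2 fun j =>
        (hG.clm_apply (differentiableAt_const _)).clm_apply (differentiableAt_const _))
  simp_rw [← hgram, h2] at h1
  rw [fderiv_const_mul hdd, smul_apply, smul_eq_mul] at h1
  have hpos : 0 < (gram (G u)).det := by
    have := pow_pos (a := |A.det|) (n := 2) (abs_pos.2 fun h => hA0 (by rw [h]; norm_num))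
    rw [sq_abs] at this
    by_contra hneg
    nlinarith
  have hs := Real.mul_self_sqrt hpos.le
  have hs0 := (Real.sqrt_pos.2 hpos).ne'
  rw [fderiv_sqrt hdd hpos.ne', smul_apply, smul_eq_mul, ← Finset.sum_div, ← h1]
  field_simp
  rw [sq, hs]
  linear_combination (-fderiv ℝ (fun v => (gram (G v)).det) u x) * hdet

/-- The trace of an endomorphism, in the standard basis and in an orthonormal basis for `B`. -/
theorem sum_apply_eq_sum_orthonormal {B : R n →L[ℝ] R n →L[ℝ] ℝ} (e : Module.Basis (Fin n) ℝ (R n))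
    (he : ∀ i j, B (e i) (e j) = if i = j then 1 else 0) (L : R n →L[ℝ] R n) :
    ∑ i, L (EuclideanSpace.single i 1) i = ∑ i, B (L (e i)) (e i) := by
  have h1 := LinearMap.trace_eq_matrix_trace ℝ (EuclideanSpace.basisFun (Fin n) ℝ).toBasis
    (L : R n →ₗ[ℝ] R n)
  have h2 := LinearMap.trace_eq_matrix_trace ℝ e (L : R n →ₗ[ℝ] R n)
  have h3 : ∀ w i, B w (e i) = e.repr w i := by
    intro w i
    have h0 : B (∑ j, e.repr w j • e j) (e i) = e.repr w i := by
      rw [map_sum, sum_apply]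
      simp [he]
    rwa [e.sum_repr] at h0
  rw [h1] at h2
  simpa [Matrix.trace, LinearMap.toMatrix_apply, h3] using h2

/-- In coordinates, `√det G · tr_G (L_X G) / 2` is the Euclidean divergence of `√det G · X`. -/
theorem sqrt_det_mul_sum_lieMetric {G : R n → R n →L[ℝ] R n →L[ℝ] ℝ} {X : R n → R n} {u : R n}
    (hG : DifferentiableAt ℝ G u) (hX : DifferentiableAt ℝ X u) (hs : ∀ v w, G u v w = G u w v)
    (hd : DifferentiableAt ℝ (fun v => √(gram (G v)).det) u)
    (e : Module.Basis (Fin n) ℝ (R n))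
    (he : ∀ i j, G u (e i) (e j) = if i = j then 1 else 0) :
    √(gram (G u)).det * ∑ i, lieMetric G X u (e i) (e i) / 2 =
      ∑ i, fderiv ℝ (fun v => √(gram (G v)).det * X v i) u (EuclideanSpace.single i 1) := by
  have hXi : ∀ i, DifferentiableAt ℝ (fun v => X v i) u := fun i =>
    (EuclideanSpace.proj (𝕜 := ℝ) i).differentiableAt.comp u hX
  have hXi' : ∀ i x, fderiv ℝ (fun v => X v i) u x = fderiv ℝ X u x i := fun i x =>
    DFunLike.congr_fun ((EuclideanSpace.proj (𝕜 := ℝ) i).hasFDerivAt.comp u hX.hasFDerivAt).fderiv x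
  have hsum : fderiv ℝ (fun v => √(gram (G v)).det) u (X u) =
      ∑ i, X u i * fderiv ℝ (fun v => √(gram (G v)).det) u (EuclideanSpace.single i 1) := by
    conv_lhs => rw [eq_sum_smul_single (X u)]
    simp
  simp_rw [fderiv_fun_mul hd (hXi _), add_apply, smul_apply, smul_eq_mul, Finset.sum_add_distrib,
    ← hsum, hXi', ← Finset.mul_sum, sum_apply_eq_sum_orthonormal e he, fderiv_sqrt_det_gram hG e he]
  rw [← mul_add, ← Finset.sum_add_distrib]
  congr 1
  refine Finset.sum_congr rfl fun i _ => ?_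
  rw [lieMetric, hs (e i)]
  ring

end GramMatrix

/-! ### The Riemannian density and the divergence in charts -/

section SmoothField

variable {n : ℕ} {M : Type*} [TopologicalSpace M] [ChartedSpace (R n) M]

/-- `X` is a smooth vector field, in terms of its components in the charts of `M`. -/
def IsSmoothField (X : (q : M) → TangentSpace (𝓡 n) q) : Prop :=
  ∀ c : M, ContDiffOn ℝ ∞ (chartField X c) (extChartAt (𝓡 n) c).target

theorem IsSmoothField.differentiableAt {X : (q : M) → TangentSpace (𝓡 n) q}
    (hX : IsSmoothField X) (c : M) {u : R n} (hu : u ∈ (extChartAt (𝓡 n) c).target) :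
    DifferentiableAt ℝ (chartField X c) u :=
  ((hX c).contDiffAt ((isOpen_target c).mem_nhds hu)).differentiableAt (by simp)

end SmoothField

section Density

variable {n : ℕ} {M : Type*} [TopologicalSpace M] [ChartedSpace (R n) M] [IsManifold (𝓡 n) ∞ M]

/-- The Riemannian density `√det (g_ij)` in the chart at `c`, as a function of the coordinates. -/
def density (g : Metric n M) (c : M) (u : R n) : ℝ := √(gram (chartMetric g c u)).det

theorem det_gram_chartMetric_pos (g : Metric n M) (c : M) {u : R n}
    (hu : u ∈ (extChartAt (𝓡 n) c).target) : 0 < (gram (chartMetric g c u)).det :=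
  det_gram_pos (chartMetric_symm g c u) fun _ => chartMetric_pos g c hu

theorem density_pos (g : Metric n M) (c : M) {u : R n}
    (hu : u ∈ (extChartAt (𝓡 n) c).target) : 0 < density g c u :=
  Real.sqrt_pos.2 (det_gram_chartMetric_pos g c hu)

theorem contDiffOn_density (g : Metric n M) (c : M) :
    ContDiffOn ℝ ∞ (density g c) (extChartAt (𝓡 n) c).target := by
  have h : ContDiffOn ℝ ∞ (fun u => (gram (chartMetric g c u)).det)
      (extChartAt (𝓡 n) c).target := by
    refine contDiff_det.comp_contDiffOn (contDiffOn_pi.2 fun i => contDiffOn_pi.2 fun j => ?_)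
    exact ((contDiffOn_chartMetric g c).clm_apply contDiffOn_const).clm_apply contDiffOn_const
  exact h.sqrt fun u hu => (det_gram_chartMetric_pos g c hu).ne'

theorem differentiableAt_density (g : Metric n M) (c : M) {u : R n}
    (hu : u ∈ (extChartAt (𝓡 n) c).target) : DifferentiableAt ℝ (density g c) u :=
  ((contDiffOn_density g c).contDiffAt ((isOpen_target c).mem_nhds hu)).differentiableAt (by simp)

/-- The classical coordinate formula `√det g · div X = ∑ i, ∂_i (√det g · X^i)`, in every chart. -/
theorem density_mul_divergence (g : Metric n M) {X : (q : M) → TangentSpace (𝓡 n) q}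
    (hX : IsSmoothField X) (c : M) {u : R n} (hu : u ∈ (extChartAt (𝓡 n) c).target) :
    density g c u * divergence g X ((extChartAt (𝓡 n) c).symm u) =
      ∑ i, fderiv ℝ (fun v => density g c v * chartField X c v i) u
        (EuclideanSpace.single i 1) := by
  -- `div X` at `q` is defined in the chart at `q`; the Lie derivative and an orthonormal basis are
  -- carried to the chart at `c` by the change of coordinates, whose differential is `dChart c q`
  set q := (extChartAt (𝓡 n) c).symm u with hq
  have hqc : q ∈ (extChartAt (𝓡 n) c).source := (extChartAt (𝓡 n) c).map_target hu
  have hcq : extChartAt (𝓡 n) c q = u := (extChartAt (𝓡 n) c).right_inv hu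
  obtain ⟨e, he⟩ := exists_metricAt_orthonormal_basis g q
  have hqt := mem_extChartAt_target (I := 𝓡 n) q
  have hd : (extChartAt (𝓡 n) q).symm (extChartAt (𝓡 n) q q) ∈ (extChartAt (𝓡 n) c).source := by
    rwa [extChartAt_to_inv]
  have hτu : (chartRep (fun q : M => q) q c (extChartAt (𝓡 n) q q) : R n) = u := by
    rw [chartRep_apply, extChartAt_to_inv, hcq]
  have hDτ : fderiv ℝ (chartRep (fun q : M => q) q c : R n → R n) (extChartAt (𝓡 n) q q) =
      dChart c q := by
    rw [fderiv_chartRep (f := fun q : M => q) contMDiff_id q c hqt hd, diff_id, dChartSymm_self,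
      extChartAt_to_inv]
    rfl
  have hev := eventually_mem_chartRep_domain (f := fun q : M => q) continuous_id q c hqt hd
  have hinj : Function.Injective (dChart c q : R n →L[ℝ] R n) := by
    intro a b hab
    have ha := dChartSymm_dChart_apply c hu a
    have hb := dChartSymm_dChart_apply c hu b
    rw [← hq] at ha hb
    rw [← ha, ← hb, hab]
  let E : R n ≃ₗ[ℝ] R n :=
    LinearEquiv.ofInjectiveEndo (dChart c q : R n →L[ℝ] R n).toLinearMap hinj
  have hE : ∀ i, (e.map E) i = dChart c q (e i) := fun i => rfl
  have heE : ∀ i j, chartMetric g c u ((e.map E) i) ((e.map E) j) = if i = j then 1 else 0 := by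
    intro i j
    rw [hE, hE, ← he, ← chartMetric_dChart g c hqc, hcq]
  rw [divergence_eq_sum g (hX.differentiableAt q hqt) e he]
  refine Eq.trans ?_ (sqrt_det_mul_sum_lieMetric (differentiableAt_chartMetric g c hu)
    (hX.differentiableAt c hu) (chartMetric_symm g c u) (differentiableAt_density g c hu)
    (e.map E) heE)
  refine congrArg _ (Finset.sum_congr rfl fun i _ => ?_)
  rw [lieMetric_pullback (X' := chartField X c) (G' := chartMetric g c)
    ((contDiffAt_chartRep (f := fun q : M => q) contMDiff_id q c hqt hd).of_le
      (WithTop.coe_le_coe.2 le_top))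
    (differentiableAt_chartMetric g q hqt)
    (by rw [hτu]; exact differentiableAt_chartMetric g c hu)
    (hX.differentiableAt q hqt) (by rw [hτu]; exact hX.differentiableAt c hu)
    (hev.mono fun v hv => chartMetric_pullback (isIsometricImmersion_id g) q c hv.1 hv.2)
    (hev.mono fun v hv => chartField_chartRep_id X q c hv.1 hv.2), hτu, hDτ, hE]

/-- The Riemannian density transforms by the Jacobian determinant. -/
theorem density_chartRep_id (g : Metric n M) (c d : M) {u : R n}
    (hu : u ∈ (extChartAt (𝓡 n) c).target)
    (hd : (extChartAt (𝓡 n) c).symm u ∈ (extChartAt (𝓡 n) d).source) :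
    density g c u = |(fderiv ℝ (chartRep (fun q : M => q) c d : R n → R n) u).det| *
      density g d (chartRep (fun q : M => q) c d u) := by
  set A := fderiv ℝ (chartRep (fun q : M => q) c d : R n → R n) u
  have h : chartMetric g c u =
      (chartMetric g d (chartRep (fun q : M => q) c d u)).bilinearComp A A := by
    ext a b
    exact chartMetric_pullback (isIsometricImmersion_id g) c d hu hd a b
  rw [density, h, det_gram_bilinearComp, Real.sqrt_mul (sq_nonneg _), Real.sqrt_sq_eq_abs]
  rfl

end Density

/-! ### Integration on a compact manifold, chart by chart -/

section Integration

/-- A product is continuous everywhere if its factors are continuous on an open set that contains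
the support of one of them. -/
theorem continuous_mul_of_tsupport_subset {E : Type*} [TopologicalSpace E] {U : Set E}
    (hU : IsOpen U) {φ w : E → ℝ} (hφ : tsupport φ ⊆ U) (hc : ContinuousOn φ U)
    (hw : ContinuousOn w U) : Continuous (fun u => φ u * w u) := by
  rw [continuous_iff_continuousAt]
  intro u
  by_cases hu : u ∈ U
  · exact (hc.continuousAt (hU.mem_nhds hu)).mul (hw.continuousAt (hU.mem_nhds hu))
  · have h0 : (fun u => φ u * w u) =ᶠ[𝓝 u] fun _ => 0 := by
      filter_upwards [notMem_tsupport_iff_eventuallyEq.1 (fun hu' => hu (hφ hu'))] with v hv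
      rw [hv]
      exact zero_mul _
    exact continuousAt_const.congr h0.symm

variable {n : ℕ} {M : Type*} [TopologicalSpace M] [ChartedSpace (R n) M]

/-- The function `h` in the chart at `c`, extended by zero outside of the chart. -/
def chartExt (h : M → ℝ) (c : M) : R n → ℝ :=
  (extChartAt (𝓡 n) c).target.indicator (h ∘ (extChartAt (𝓡 n) c).symm)

theorem chartExt_of_mem (h : M → ℝ) (c : M) {u : R n} (hu : u ∈ (extChartAt (𝓡 n) c).target) :
    chartExt h c u = h ((extChartAt (𝓡 n) c).symm u) := indicator_of_mem hu _

theorem chartExt_of_notMem (h : M → ℝ) (c : M) {u : R n}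
    (hu : u ∉ (extChartAt (𝓡 n) c).target) : chartExt h c u = 0 := indicator_of_notMem hu _

theorem chartExt_eventuallyEq {h : M → ℝ} {c : M} {u : R n}
    (hu : u ∈ (extChartAt (𝓡 n) c).target) :
    chartExt h c =ᶠ[𝓝 u] h ∘ (extChartAt (𝓡 n) c).symm := by
  filter_upwards [(isOpen_target c).mem_nhds hu] with v hv using chartExt_of_mem h c hv

theorem continuousOn_chartExt {h : M → ℝ} {c : M}
    (hc : ContinuousOn (h ∘ (extChartAt (𝓡 n) c).symm) (extChartAt (𝓡 n) c).target) :
    ContinuousOn (chartExt h c : R n → ℝ) (extChartAt (𝓡 n) c).target :=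
  hc.congr fun _ hu => chartExt_of_mem h c hu

variable [CompactSpace M]

theorem isCompact_image_tsupport {h : M → ℝ} {c : M} (hh : tsupport h ⊆ (chartAt (R n) c).source) :
    IsCompact (extChartAt (𝓡 n) c '' tsupport h) := by
  refine (isClosed_tsupport h).isCompact.image_of_continuousOn ?_
  refine (continuousOn_extChartAt c).mono ?_
  rwa [extChartAt_source]

theorem tsupport_chartExt_subset_image {h : M → ℝ} {c : M}
    (hh : tsupport h ⊆ (chartAt (R n) c).source) :
    tsupport (chartExt h c : R n → ℝ) ⊆ extChartAt (𝓡 n) c '' tsupport h := by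
  refine closure_minimal (fun u hu => ?_) (isCompact_image_tsupport hh).isClosed
  by_cases hut : u ∈ (extChartAt (𝓡 n) c).target
  · rw [Function.mem_support, chartExt_of_mem h c hut] at hu
    exact ⟨_, subset_tsupport h hu, (extChartAt (𝓡 n) c).right_inv hut⟩
  · exact absurd (chartExt_of_notMem h c hut) hu

theorem tsupport_chartExt_subset_target {h : M → ℝ} {c : M}
    (hh : tsupport h ⊆ (chartAt (R n) c).source) :
    tsupport (chartExt h c : R n → ℝ) ⊆ (extChartAt (𝓡 n) c).target := by
  refine (tsupport_chartExt_subset_image hh).trans ?_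
  rintro _ ⟨q, hq, rfl⟩
  exact (extChartAt (𝓡 n) c).map_source (by rw [extChartAt_source]; exact hh hq)

theorem hasCompactSupport_chartExt {h : M → ℝ} {c : M}
    (hh : tsupport h ⊆ (chartAt (R n) c).source) :
    HasCompactSupport (chartExt h c : R n → ℝ) :=
  (isCompact_image_tsupport hh).of_isClosed_subset (isClosed_tsupport _)
    (tsupport_chartExt_subset_image hh)

theorem continuous_chartExt_mul {h : M → ℝ} {c : M}
    (hh : tsupport h ⊆ (chartAt (R n) c).source)
    (hc : ContinuousOn (h ∘ (extChartAt (𝓡 n) c).symm) (extChartAt (𝓡 n) c).target)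
    {w : R n → ℝ} (hw : ContinuousOn w (extChartAt (𝓡 n) c).target) :
    Continuous (fun u => chartExt h c u * w u) :=
  continuous_mul_of_tsupport_subset (isOpen_target c) (tsupport_chartExt_subset_target hh)
    (continuousOn_chartExt hc) hw

theorem hasCompactSupport_chartExt_mul {h : M → ℝ} {c : M}
    (hh : tsupport h ⊆ (chartAt (R n) c).source) (w : R n → ℝ) :
    HasCompactSupport (fun u => chartExt h c u * w u) :=
  (hasCompactSupport_chartExt hh).mul_right

theorem integrable_chartExt_mul {h : M → ℝ} {c : M}
    (hh : tsupport h ⊆ (chartAt (R n) c).source)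
    (hc : ContinuousOn (h ∘ (extChartAt (𝓡 n) c).symm) (extChartAt (𝓡 n) c).target)
    {w : R n → ℝ} (hw : ContinuousOn w (extChartAt (𝓡 n) c).target) :
    Integrable (fun u => chartExt h c u * w u) :=
  (continuous_chartExt_mul hh hc hw).integrable_of_hasCompactSupport
    (hasCompactSupport_chartExt_mul hh w)

end Integration

/-! ### The divergence theorem on a compact manifold -/

section FieldDeriv

variable {n : ℕ} {M : Type*} [TopologicalSpace M] [ChartedSpace (R n) M]

/-- The derivative `X h` of a function `h` along a vector field `X`. -/
def fieldDeriv (X : (q : M) → TangentSpace (𝓡 n) q) (h : M → ℝ) (q : M) : ℝ :=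
  mfderiv (𝓡 n) 𝓘(ℝ, ℝ) h q (X q)

theorem tsupport_fieldDeriv_subset (X : (q : M) → TangentSpace (𝓡 n) q) (h : M → ℝ) :
    tsupport (fieldDeriv X h) ⊆ tsupport h := by
  refine closure_minimal (fun q hq => ?_) (isClosed_tsupport h)
  by_contra hq'
  refine hq ?_
  unfold fieldDeriv
  rw [(notMem_tsupport_iff_eventuallyEq.1 hq').mfderiv_eq]
  have : mfderiv (𝓡 n) 𝓘(ℝ, ℝ) (0 : M → ℝ) q = 0 := mfderiv_const
  rw [this]
  rfl

end FieldDeriv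

section DivergenceTheorem

variable {n : ℕ} {M : Type*} [TopologicalSpace M] [ChartedSpace (R n) M] [IsManifold (𝓡 n) ∞ M]

theorem fieldDeriv_extChartAt_symm (X : (q : M) → TangentSpace (𝓡 n) q) {h : M → ℝ}
    (hh : ContMDiff (𝓡 n) 𝓘(ℝ, ℝ) ∞ h) (c : M) {u : R n}
    (hu : u ∈ (extChartAt (𝓡 n) c).target) :
    fieldDeriv X h ((extChartAt (𝓡 n) c).symm u) =
      fderiv ℝ (h ∘ (extChartAt (𝓡 n) c).symm) u (chartField X c u) := by
  have h1 : MDifferentiableAt 𝓘(ℝ, R n) (𝓡 n) (extChartAt (𝓡 n) c).symm u :=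
    ((contMDiffOn_extChartAt_symm (n := ∞) c).contMDiffAt
    ((isOpen_target c).mem_nhds hu)).mdifferentiableAt (by simp)
  have h2 : MDifferentiableAt (𝓡 n) 𝓘(ℝ, ℝ) h ((extChartAt (𝓡 n) c).symm u) :=
    hh.contMDiffAt.mdifferentiableAt (by simp)
  rw [← mfderiv_eq_fderiv, mfderiv_comp u h2 h1]
  exact congrArg (mfderiv (𝓡 n) 𝓘(ℝ, ℝ) h ((extChartAt (𝓡 n) c).symm u))
    (dChartSymm_chartField X c hu).symm

theorem contDiffOn_comp_extChartAt_symm {h : M → ℝ} (hh : ContMDiff (𝓡 n) 𝓘(ℝ, ℝ) ∞ h) (c : M) :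
    ContDiffOn ℝ ∞ (h ∘ (extChartAt (𝓡 n) c).symm) (extChartAt (𝓡 n) c).target :=
  ContMDiffOn.contDiffOn_comp_extChartAt_symm hh.contMDiffOn

theorem continuousOn_fieldDeriv {X : (q : M) → TangentSpace (𝓡 n) q} (hX : IsSmoothField X)
    {h : M → ℝ} (hh : ContMDiff (𝓡 n) 𝓘(ℝ, ℝ) ∞ h) (c : M) :
    ContinuousOn (fieldDeriv X h ∘ (extChartAt (𝓡 n) c).symm) (extChartAt (𝓡 n) c).target := by
  refine ContinuousOn.congr ?_ fun u hu => fieldDeriv_extChartAt_symm X hh c hu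
  exact ((contDiffOn_comp_extChartAt_symm hh c).continuousOn_fderiv_of_isOpen (isOpen_target c)
    (by simp)).clm_apply (hX c).continuousOn

theorem contDiffOn_density_mul_chartField (g : Metric n M) {X : (q : M) → TangentSpace (𝓡 n) q}
    (hX : IsSmoothField X) (c : M) (i : Fin n) :
    ContDiffOn ℝ ∞ (fun v => density g c v * chartField X c v i) (extChartAt (𝓡 n) c).target :=
  (contDiffOn_density g c).mul
    ((EuclideanSpace.proj (𝕜 := ℝ) i).contDiff.comp_contDiffOn (hX c))

theorem continuousOn_divergence (g : Metric n M) {X : (q : M) → TangentSpace (𝓡 n) q}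
    (hX : IsSmoothField X) (c : M) :
    ContinuousOn (divergence g X ∘ (extChartAt (𝓡 n) c).symm) (extChartAt (𝓡 n) c).target := by
  have hW := contDiffOn_density_mul_chartField g hX c
  have h : ContinuousOn (fun u => (∑ i, fderiv ℝ (fun v => density g c v * chartField X c v i) u
      (EuclideanSpace.single i 1)) / density g c u) (extChartAt (𝓡 n) c).target := by
    refine ContinuousOn.div (continuousOn_finsetSum _ fun i _ => ?_)
      (contDiffOn_density g c).continuousOn fun u hu => (density_pos g c hu).ne'
    exact ((hW i).continuousOn_fderiv_of_isOpen (isOpen_target c) (by simp)).clm_apply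
      continuousOn_const
  refine h.congr fun u hu => ?_
  simp only
  rw [← density_mul_divergence g hX c hu, mul_div_cancel_left₀ _ (density_pos g c hu).ne']
  rfl

/-- The integral of `h` with respect to the Riemannian volume, computed in the chart at `c`; it is
meaningful for functions `h` whose support lies in this chart. -/
def chartIntegral (g : Metric n M) (c : M) (h : M → ℝ) : ℝ :=
  ∫ u, chartExt h c u * density g c u

/-- The integral of a function supported in two charts can be computed in either of them, by the
change of variables formula. -/
theorem chartIntegral_congr_chart (g : Metric n M) (c d : M) {h : M → ℝ}
    (hc : Function.support h ⊆ (chartAt (R n) c).source)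
    (hd : Function.support h ⊆ (chartAt (R n) d).source) :
    chartIntegral g c h = chartIntegral g d h := by
  -- only the overlap of the two charts contributes to the integral
  have key : ∀ c d : M, Function.support h ⊆ (chartAt (R n) d).source →
      chartIntegral g c h = ∫ u in (extChartAt (𝓡 n) c).target ∩
        (extChartAt (𝓡 n) c).symm ⁻¹' (extChartAt (𝓡 n) d).source,
        chartExt h c u * density g c u := by
    intro c d hd
    refine (setIntegral_eq_integral_of_forall_compl_eq_zero fun u hu => ?_).symm
    by_cases hut : u ∈ (extChartAt (𝓡 n) c).target
    · have : h ((extChartAt (𝓡 n) c).symm u) = 0 := by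
        by_contra hne
        refine hu ⟨hut, ?_⟩
        rw [mem_preimage, extChartAt_source]
        exact hd hne
      rw [chartExt_of_mem h c hut, this, zero_mul]
    · rw [chartExt_of_notMem h c hut, zero_mul]
  rw [key c d hd, key d c hc]
  set S := (extChartAt (𝓡 n) c).target ∩
    (extChartAt (𝓡 n) c).symm ⁻¹' (extChartAt (𝓡 n) d).source with hS
  have hSo : IsOpen S := (continuousOn_extChartAt_symm c).isOpen_inter_preimage
    (isOpen_target c) (isOpen_extChartAt_source d)
  set τ : R n → R n := chartRep (fun q : M => q) c d with hτ
  have hτS : ∀ u ∈ S, τ u ∈ (extChartAt (𝓡 n) d).target ∧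
      (extChartAt (𝓡 n) d).symm (τ u) = (extChartAt (𝓡 n) c).symm u := fun u hu =>
    ⟨(extChartAt (𝓡 n) d).map_source hu.2, (extChartAt (𝓡 n) d).left_inv hu.2⟩
  have himage : τ '' S = (extChartAt (𝓡 n) d).target ∩
      (extChartAt (𝓡 n) d).symm ⁻¹' (extChartAt (𝓡 n) c).source := by
    ext v
    constructor
    · rintro ⟨u, hu, rfl⟩
      refine ⟨(hτS u hu).1, ?_⟩
      rw [mem_preimage, (hτS u hu).2]
      exact (extChartAt (𝓡 n) c).map_target hu.1
    · intro hv
      have h1 := (extChartAt (𝓡 n) c).left_inv hv.2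
      refine ⟨extChartAt (𝓡 n) c ((extChartAt (𝓡 n) d).symm v),
        ⟨(extChartAt (𝓡 n) c).map_source hv.2, ?_⟩, ?_⟩
      · rw [mem_preimage, h1]
        exact (extChartAt (𝓡 n) d).map_target hv.1
      · rw [hτ, chartRep_apply, h1, (extChartAt (𝓡 n) d).right_inv hv.1]
  have hinj : InjOn τ S := by
    intro u hu v hv huv
    have := (hτS u hu).2.symm.trans ((congrArg _ huv).trans (hτS v hv).2)
    rw [← (extChartAt (𝓡 n) c).right_inv hu.1, this, (extChartAt (𝓡 n) c).right_inv hv.1]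
  have hder : ∀ u ∈ S, HasFDerivWithinAt τ (fderiv ℝ τ u) S u := fun u hu =>
    ((contDiffAt_chartRep (f := fun q : M => q) contMDiff_id c d hu.1 hu.2).differentiableAt
      (by simp)).hasFDerivAt.hasFDerivWithinAt
  rw [← himage, integral_image_eq_integral_abs_det_fderiv_smul volume hSo.measurableSet hder hinj]
  refine setIntegral_congr_fun hSo.measurableSet fun u hu => ?_
  simp only [smul_eq_mul]
  rw [density_chartRep_id g c d hu.1 hu.2, chartExt_of_mem h c hu.1,
    chartExt_of_mem h d (hτS u hu).1, (hτS u hu).2]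
  ring

variable [CompactSpace M]

theorem contDiff_chartExt {h : M → ℝ} (hh : ContMDiff (𝓡 n) 𝓘(ℝ, ℝ) ∞ h) {c : M}
    (hc : tsupport h ⊆ (chartAt (R n) c).source) : ContDiff ℝ ∞ (chartExt h c : R n → ℝ) := by
  rw [contDiff_iff_contDiffAt]
  intro u
  by_cases hu : u ∈ (extChartAt (𝓡 n) c).target
  · exact ((contDiffOn_comp_extChartAt_symm hh c).contDiffAt
      ((isOpen_target c).mem_nhds hu)).congr_of_eventuallyEq (chartExt_eventuallyEq hu)
  · exact contDiffAt_const.congr_of_eventuallyEq (notMem_tsupport_iff_eventuallyEq.1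
      fun hu' => hu (tsupport_chartExt_subset_target hc hu'))

/-- Integration by parts for functions supported in one chart. -/
theorem chartIntegral_mul_divergence (g : Metric n M) {X : (q : M) → TangentSpace (𝓡 n) q}
    (hX : IsSmoothField X) {h : M → ℝ} (hh : ContMDiff (𝓡 n) 𝓘(ℝ, ℝ) ∞ h) {c : M}
    (hc : tsupport h ⊆ (chartAt (R n) c).source) :
    chartIntegral g c (fun q => h q * divergence g X q) =
      -chartIntegral g c (fieldDeriv X h) := by
  have hW := contDiffOn_density_mul_chartField g hX c
  have hφ := contDiff_chartExt hh hc
  have hφs := hasCompactSupport_chartExt hc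
  have hφt := tsupport_chartExt_subset_target hc
  have hhc := (contDiffOn_comp_extChartAt_symm hh c).continuousOn
  have hi1 : ∀ i, Integrable (fun u => chartExt h c u *
      fderiv ℝ (fun v => density g c v * chartField X c v i) u (EuclideanSpace.single i 1)) :=
    fun i => integrable_chartExt_mul hc hhc
      (((hW i).continuousOn_fderiv_of_isOpen (isOpen_target c) (by simp)).clm_apply
        continuousOn_const)
  have hi2 : ∀ i, Integrable (fun u => chartExt h c u *
      (density g c u * chartField X c u i)) :=
    fun i => integrable_chartExt_mul hc hhc (hW i).continuousOn
  have hi3 : ∀ i, Integrable (fun u => fderiv ℝ (chartExt h c : R n → ℝ) u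
      (EuclideanSpace.single i 1) * (density g c u * chartField X c u i)) := by
    intro i
    refine Continuous.integrable_of_hasCompactSupport (continuous_mul_of_tsupport_subset
      (isOpen_target c) ((tsupport_fderiv_apply_subset ℝ _).trans hφt) ?_ (hW i).continuousOn)
      (hφs.fderiv_apply ℝ _).mul_right
    exact ((hφ.continuous_fderiv (by simp)).clm_apply continuous_const).continuousOn
  have hleft : ∀ u, chartExt (fun q => h q * divergence g X q) c u * density g c u =
      ∑ i, chartExt h c u * fderiv ℝ (fun v => density g c v * chartField X c v i) u
        (EuclideanSpace.single i 1) := by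
    intro u
    by_cases hu : u ∈ (extChartAt (𝓡 n) c).target
    · rw [← Finset.mul_sum, ← density_mul_divergence g hX c hu, chartExt_of_mem _ c hu,
        chartExt_of_mem _ c hu]
      ring
    · simp [chartExt_of_notMem _ c hu]
  have hright : ∀ u, chartExt (fieldDeriv X h) c u * density g c u =
      ∑ i, fderiv ℝ (chartExt h c : R n → ℝ) u (EuclideanSpace.single i 1) *
        (density g c u * chartField X c u i) := by
    intro u
    by_cases hu : u ∈ (extChartAt (𝓡 n) c).target
    · rw [chartExt_of_mem _ c hu, fieldDeriv_extChartAt_symm X hh c hu,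
        (chartExt_eventuallyEq hu).fderiv_eq]
      conv_lhs => rw [eq_sum_smul_single (chartField X c u)]
      rw [map_sum, Finset.sum_mul]
      refine Finset.sum_congr rfl fun i _ => ?_
      rw [map_smul, smul_eq_mul]
      ring
    · have h0 : fderiv ℝ (chartExt h c : R n → ℝ) u = 0 := by
        by_contra hne
        exact hu (hφt (support_fderiv_subset ℝ hne))
      simp [chartExt_of_notMem _ c hu, h0]
  unfold chartIntegral
  simp_rw [hleft, hright]
  rw [integral_finsetSum _ fun i _ => hi1 i, integral_finsetSum _ fun i _ => hi3 i,
    ← Finset.sum_neg_distrib]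
  refine Finset.sum_congr rfl fun i _ => ?_
  exact integral_mul_fderiv_eq_neg_fderiv_mul_of_integrable (hi3 i) (hi1 i) (hi2 i)
    (fun u _ => hφ.contDiffAt.differentiableAt (by simp))
    (fun u hu => ((hW i).contDiffAt ((isOpen_target c).mem_nhds (hφt hu))).differentiableAt
      (by simp))

/-- A consequence of the divergence theorem: a smooth vector field with nonnegative divergence on a
compact Riemannian manifold is divergence free. -/
theorem divergence_eq_zero_of_nonneg [T2Space M] (g : Metric n M)
    {X : (q : M) → TangentSpace (𝓡 n) q} (hX : IsSmoothField X)
    (hdiv : ∀ q, 0 ≤ divergence g X q) (q : M) : divergence g X q = 0 := by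
  obtain ⟨ρ, hρ⟩ := SmoothPartitionOfUnity.exists_isSubordinate_chartAt_source (𝓡 n) M
  have hfin : {i | (Function.support (ρ i)).Nonempty}.Finite :=
    ρ.locallyFinite.finite_nonempty_of_compact
  set J := hfin.toFinset with hJ
  have hsmooth : ∀ i, ContMDiff (𝓡 n) 𝓘(ℝ, ℝ) ∞ (ρ i) := fun i => (ρ i).contMDiff
  have hsum : ∀ q, ∑ i ∈ J, ρ i q = 1 := by
    intro q
    rw [← ρ.sum_eq_one (mem_univ q)]
    refine (finsum_eq_sum_of_support_subset _ fun i hi => ?_).symm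
    rw [hJ, hfin.coe_toFinset]
    exact ⟨q, hi⟩
  -- the derivatives of a partition of unity add up to zero
  have hdsum : ∀ q, ∑ i ∈ J, fieldDeriv X (ρ i) q = 0 := by
    intro q
    have hq := mem_extChartAt_target (I := 𝓡 n) q
    have h1 : ∀ i, fieldDeriv X (ρ i) q = fderiv ℝ (ρ i ∘ (extChartAt (𝓡 n) q).symm)
        (extChartAt (𝓡 n) q q) (chartField X q (extChartAt (𝓡 n) q q)) := by
      intro i
      rw [← fieldDeriv_extChartAt_symm X (hsmooth i) q hq, extChartAt_to_inv]
    have h2 : (∑ i ∈ J, ρ i ∘ (extChartAt (𝓡 n) q).symm : R n → ℝ) = fun _ => (1 : ℝ) := by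
      funext u
      simp only [Finset.sum_apply, Function.comp_apply, hsum]
    simp_rw [h1]
    rw [← sum_apply, ← fderiv_sum, h2, fderiv_fun_const]
    · rfl
    · exact fun i _ => ((contDiffOn_comp_extChartAt_symm (hsmooth i) q).contDiffAt
        ((isOpen_target q).mem_nhds hq)).differentiableAt (by simp)
  -- the functions `ρ j * X (ρ i)` are supported in the charts at `i` and at `j`
  have hs1 : ∀ i j, tsupport (fun q => ρ j q * fieldDeriv X (ρ i) q) ⊆ tsupport (ρ i) :=
    fun i j => (tsupport_mul_subset_right (f := ρ j) (g := fieldDeriv X (ρ i))).trans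
      (tsupport_fieldDeriv_subset X (ρ i))
  have hs2 : ∀ i j, tsupport (fun q => ρ j q * fieldDeriv X (ρ i) q) ⊆ tsupport (ρ j) :=
    fun i j => tsupport_mul_subset_left (f := ρ j) (g := fieldDeriv X (ρ i))
  have hint : ∀ i j c, tsupport (fun q => ρ j q * fieldDeriv X (ρ i) q) ⊆
      (chartAt (R n) c).source → Integrable (fun u =>
        chartExt (fun q => ρ j q * fieldDeriv X (ρ i) q) c u * density g c u) := fun i j c hc =>
    integrable_chartExt_mul hc
      ((contDiffOn_comp_extChartAt_symm (hsmooth j) c).continuousOn.mul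
        (continuousOn_fieldDeriv hX (hsmooth i) c)) (contDiffOn_density g c).continuousOn
  have hzero : ∑ i ∈ J, chartIntegral g i (fun q => ρ i q * divergence g X q) = 0 := by
    have h1 : ∀ i ∈ J, chartIntegral g i (fieldDeriv X (ρ i)) =
        ∑ j ∈ J, chartIntegral g i (fun q => ρ j q * fieldDeriv X (ρ i) q) := by
      intro i _
      unfold chartIntegral
      rw [← integral_finsetSum _ fun j _ => hint i j i ((hs1 i j).trans (hρ i))]
      congr 1
      funext u
      by_cases hu : u ∈ (extChartAt (𝓡 n) i).target
      · simp only [chartExt_of_mem _ i hu]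
        rw [← Finset.sum_mul, ← Finset.sum_mul, hsum, one_mul]
      · simp [chartExt_of_notMem _ i hu]
    have h2 : ∀ j ∈ J, ∑ i ∈ J, chartIntegral g j (fun q => ρ j q * fieldDeriv X (ρ i) q) = 0 := by
      intro j _
      unfold chartIntegral
      rw [← integral_finsetSum _ fun i _ => hint i j j ((hs2 i j).trans (hρ j))]
      refine integral_eq_zero_of_ae (Eventually.of_forall fun u => ?_)
      by_cases hu : u ∈ (extChartAt (𝓡 n) j).target
      · simp only [chartExt_of_mem _ j hu]
        rw [← Finset.sum_mul, ← Finset.mul_sum, hdsum, mul_zero, zero_mul]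
        rfl
      · simp [chartExt_of_notMem _ j hu]
    rw [Finset.sum_congr rfl fun i _ => chartIntegral_mul_divergence g hX (hsmooth i) (hρ i),
      Finset.sum_neg_distrib, Finset.sum_congr rfl h1, Finset.sum_comm, neg_eq_zero]
    refine Finset.sum_eq_zero fun j hj => ?_
    rw [← h2 j hj]
    refine Finset.sum_congr rfl fun i _ => ?_
    exact chartIntegral_congr_chart g i j
      (((subset_tsupport _).trans (hs1 i j)).trans (hρ i))
      (((subset_tsupport _).trans (hs2 i j)).trans (hρ j))
  -- so every one of these integrals, of nonnegative functions, vanishes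
  have hnonneg : ∀ i u, 0 ≤ chartExt (fun q => ρ i q * divergence g X q) i u * density g i u := by
    intro i u
    refine mul_nonneg ?_ (Real.sqrt_nonneg _)
    by_cases hu : u ∈ (extChartAt (𝓡 n) i).target
    · rw [chartExt_of_mem _ i hu]
      exact mul_nonneg (ρ.nonneg i _) (hdiv _)
    · rw [chartExt_of_notMem _ i hu]
  have heach := (Finset.sum_eq_zero_iff_of_nonneg fun i _ => integral_nonneg (hnonneg i)).1 hzero
  obtain ⟨i, hiJ, hi⟩ : ∃ i ∈ J, ρ i q ≠ 0 := by
    by_contra hne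
    push Not at hne
    have := hsum q
    rw [Finset.sum_eq_zero hne] at this
    exact zero_ne_one this
  have hqi : q ∈ (extChartAt (𝓡 n) i).source := by
    rw [extChartAt_source]
    exact hρ i (subset_tsupport _ hi)
  have hut := (extChartAt (𝓡 n) i).map_source hqi
  have hcs : tsupport (fun q => ρ i q * divergence g X q) ⊆ (chartAt (R n) i).source :=
    (tsupport_mul_subset_left (f := ρ i) (g := divergence g X)).trans (hρ i)
  have hcc : ContinuousOn ((fun q => ρ i q * divergence g X q) ∘ (extChartAt (𝓡 n) i).symm)
      (extChartAt (𝓡 n) i).target :=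
    (contDiffOn_comp_extChartAt_symm (hsmooth i) i).continuousOn.mul
      (continuousOn_divergence g hX i)
  have hcont := continuous_chartExt_mul hcs hcc (contDiffOn_density g i).continuousOn
  have hae := (integral_eq_zero_iff_of_nonneg (hnonneg i) (integrable_chartExt_mul hcs hcc
    (contDiffOn_density g i).continuousOn)).1 (heach i hiJ)
  have hfun := (hcont.ae_eq_iff_eq volume continuous_const).1 hae
  have hval := congrFun hfun (extChartAt (𝓡 n) i q)
  rw [chartExt_of_mem _ i hut, (extChartAt (𝓡 n) i).left_inv hqi] at hval
  have h0 := (mul_eq_zero.1 hval).resolve_right (density_pos g i hut).ne'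
  exact (mul_eq_zero.1 h0).resolve_left hi

end DivergenceTheorem

end MCFSoliton

end

theorem mainTheorem6 {n k : ℕ}
    {M : Type*} [TopologicalSpace M] [T2Space M] [SecondCountableTopology M]
    [ChartedSpace (MCFSoliton.R n) M] [IsManifold (𝓡 n) ∞ M]
    {N : Type*} [TopologicalSpace N] [T2Space N] [SecondCountableTopology N]
    [ChartedSpace (MCFSoliton.R k) N] [IsManifold (𝓡 k) ∞ N]
    (gM : MCFSoliton.Metric n M) (gN : MCFSoliton.Metric k N)
    (ξ : (y : N) → TangentSpace (𝓡 k) y) (hξ : MCFSoliton.IsKilling gN ξ)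
    (f : M → N) (hf : MCFSoliton.IsSoliton gM gN f ξ) :
    (∀ p : M,
      MCFSoliton.divergence gM (fun q => MCFSoliton.tangentPart gM gN f q (ξ (f q))) p =
        MCFSoliton.metricAt gN (f p) (MCFSoliton.meanCurvature gM gN f p)
          (MCFSoliton.meanCurvature gM gN f p)) ∧
    (CompactSpace M → MCFSoliton.IsMinimal gM gN f) := by
  have hdiv := MCFSoliton.divergence_tangentField hξ hf
  refine ⟨hdiv, fun _ p => ?_⟩
  have h0 := MCFSoliton.divergence_eq_zero_of_nonneg gM
    (MCFSoliton.contDiffOn_chartField_tangentPart hf.immersion hξ.smooth)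
    (fun q => ?_) p
  · rw [hdiv p] at h0
    by_contra hne
    exact (MCFSoliton.metricAt_pos gN (f p) hne).ne' h0
  · rw [hdiv q]
    by_cases hH : MCFSoliton.meanCurvature gM gN f q = 0
    · rw [hH, map_zero]
    · exact (MCFSoliton.metricAt_pos gN (f q) hH).le
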